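/- For $n\ge 1$ let $\Lambda_n$ be one of the following two graphs drawn on the sphere. Free boundary conditions: the subgraph of $\mathbb Z^2$ induced on $[-n,n]^2\cap\mathbb Z^2$; its faces are the $(2n)^2$ unit squares of the box and the outer face containing $\infty$. Zero boundary conditions: the graph obtained from $\mathbb Z^2$ by identifying all vertices outside $[-n,n]^2$ with one vertex $\infty$ and deleting the loops at $\infty$; its faces correspond to the $(2n+2)^2$ unit squares having at least one corner in $[-n,n]^2$. Let $F$ be the set of faces, all oriented counterclockwise (by the outer normal of the sphere), and fix a marked face $f_0\in F$. A 2-form is a function $g:F\to\mathbb R$ with $g(f_0)=0$, and $\langle g_1,g_2\rangle=\sum_{f\in F} g_1(f)g_2(f)$. The Laplacian on 2-forms is $$\Delta g(f)=\mathbf 1_{f\ne f_0}\sum_{e}\bigl(g(f_e)-g(f)\bigr),$$ where the sum is over the edges $e$ on the boundary of $f$ and $f_e$ is the face on the other side of $e$; it is negative definite, hence invertible. For $f\in F$ the 2-form $1_f$ is the indicator of $f$ (the zero form if $f=f_0$). The Coulomb gas at inverse temperature $\beta>0$ is the random integer-valued 2-form $q$ with $$\mathbb P^{Coul}_\beta[q=Q]\propto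 \exp\Bigl(-\tfrac{(2\pi)^2\beta}{2}\langle Q,(-\Delta)^{-1}Q\rangle\Bigr).$$ Let $\mathrm{Var}^{IG}(a,\beta)$ be the variance of the random integer $X$ with $\mathbb P[X=k]\propto e^{-\frac{\beta}{2}(k-a)^2}$, $k\in\mathbb Z$, and let $$M(\beta)=(2\pi)^2\beta\,\inf_{a\in[0,1/2]}\mathrm{Var}^{IG}\bigl(a,(2\pi)^2\beta\bigr).$$ Theorem. There is a constant $K$ such that for all $\beta\ge\frac13$, all $n\ge1$, either of the two boundary conditions, every marked face $f_0$ and all faces $f,f'$ of $\Lambda_n$, the expectation below is real and $$\mathbb E^{Coul}_\beta\Bigl[e^{2i\pi(\Delta^{-1}q(f)-\Delta^{-1}q(f'))}\Bigr]\le K\exp\Bigl(-\tfrac12\,\frac{M(\beta)}{2(2\pi)^2\beta}\,\bigl\langle 1_f-1_{f'},(-\Delta)^{-1}(1_f-1_{f'})\bigr\rangle\Bigr).$$ -/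

import Mathlib

open MeasureTheory ProbabilityTheory
open scoped ENNReal

noncomputable section

namespace Coulomb

/-! ### Discrete Gibbs measures and integer-valued Gaussian variables -/

/-- The measure on a discrete space giving to each configuration `a` a mass proportional to
`exp (-H a)`. -/
def gibbs {α : Type} [MeasurableSpace α] (H : α → ℝ) : Measure α :=
  (∑' a, ENNReal.ofReal (Real.exp (-H a)))⁻¹ •
    Measure.sum fun a => ENNReal.ofReal (Real.exp (-H a)) • Measure.dirac a

/-- A summable weight on a non-empty space gives a probability measure. -/
theorem isProbabilityMeasure_gibbs {α : Type} [MeasurableSpace α] [Nonempty α] {H : α → ℝ}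
    (hH : Summable fun a => Real.exp (-H a)) : IsProbabilityMeasure (gibbs H) := by
  constructor
  have h1 : (∑' a, ENNReal.ofReal (Real.exp (-H a))) ≠ 0 := by
    intro h
    have := ENNReal.tsum_eq_zero.1 h (Classical.arbitrary α)
    rw [ENNReal.ofReal_eq_zero] at this
    exact absurd (Real.exp_pos _) (not_lt.2 this)
  have h2 : (∑' a, ENNReal.ofReal (Real.exp (-H a))) ≠ ∞ := hH.tsum_ofReal_ne_top
  simp only [gibbs, Measure.smul_apply, Measure.sum_apply _ MeasurableSet.univ, smul_eq_mul,
    measure_univ, mul_one]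
  exact ENNReal.inv_mul_cancel h1 h2

/-- The law of an integer-valued Gaussian variable centred at `a`, at inverse temperature `β`:
`P[X = k] ∝ exp (-(β / 2) * (k - a) ^ 2)`. -/
def intGaussian (a β : ℝ) : Measure ℤ :=
  gibbs fun k : ℤ => β / 2 * ((k : ℝ) - a) ^ 2

theorem summable_intGaussian (a : ℝ) {β : ℝ} (hβ : 0 < β) :
    Summable fun k : ℤ => Real.exp (-(β / 2 * ((k : ℝ) - a) ^ 2)) := by
  have h := summable_pow_mul_jacobiTheta₂_term_bound (β * |a| / (2 * Real.pi))
    (T := β / (2 * Real.pi)) (by positivity) 0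
  refine Summable.of_nonneg_of_le (fun _ => (Real.exp_pos _).le) (fun k => ?_) h
  rw [pow_zero, one_mul, Real.exp_le_exp]
  have e : -Real.pi * (β / (2 * Real.pi) * (k : ℝ) ^ 2
      - 2 * (β * |a| / (2 * Real.pi)) * ((|k| : ℤ) : ℝ))
      = -(β / 2 * (k : ℝ) ^ 2) + β * (|a| * |(k : ℝ)|) := by
    push_cast
    field_simp
    ring
  rw [e]
  have h1 : a * k ≤ |a| * |(k : ℝ)| := by rw [← abs_mul]; exact le_abs_self _
  nlinarith [mul_le_mul_of_nonneg_left h1 hβ.le, mul_nonneg hβ.le (sq_nonneg a)]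

theorem isProbabilityMeasure_intGaussian (a : ℝ) {β : ℝ} (hβ : 0 < β) :
    IsProbabilityMeasure (intGaussian a β) :=
  isProbabilityMeasure_gibbs (summable_intGaussian a hβ)

/-- The variance of an integer-valued Gaussian variable. -/
def varIG (a β : ℝ) : ℝ :=
  variance (fun k : ℤ => (k : ℝ)) (intGaussian a β)

/-- The error function
`M(β) = (2π)² β inf_{a ∈ [0, 1/2]} Var^{IG}(a, (2π)² β)`. -/
def errorM (β : ℝ) : ℝ :=
  (2 * Real.pi) ^ 2 * β *
    sInf ((fun a : ℝ => varIG a ((2 * Real.pi) ^ 2 * β)) '' Set.Icc 0 (1 / 2))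

/-! ### Edges and faces of a graph on the sphere, and discrete calculus -/

/-- The edges and faces of a finite connected graph drawn on the sphere. Every edge is given a
fixed orientation; `left e` and `right e` are the faces on its two sides. Faces are
oriented counterclockwise (by the outer normal of the sphere), so that the boundary of `f` runs
along `e` in the direction of `e` when `f = left e`, and against it when `f = right e`. -/
structure SphereGraph where
  E : Type
  F : Type
  [fintypeE : Fintype E]
  [fintypeF : Fintype F]
  [decidableEqF : DecidableEq F]
  left : E → F
  right : E → F
  /-- Any two faces are joined by a chain of faces, consecutive ones sharing an edge. -/
  dual_connected : ∀ f f' : F, Relation.EqvGen (fun a b => ∃ e, left e = a ∧ right e = b) f f'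

attribute [instance] SphereGraph.fintypeE SphereGraph.fintypeF SphereGraph.decidableEqF

namespace SphereGraph

variable (G : SphereGraph) (f₀ : G.F)

/-- `1`-forms, read along the fixed orientation of the edges. -/
abbrev OneForm : Type := G.E → ℝ

/-- `2`-forms rooted at the marked face `f₀`, read along the fixed orientation of the faces. -/
def TwoForm : Submodule ℝ (G.F → ℝ) where
  carrier := {g | g f₀ = 0}
  add_mem' := by
    intro a b ha hb
    simp only [Set.mem_ofPred_eq, Pi.add_apply] at *
    rw [ha, hb, add_zero]
  zero_mem' := rfl
  smul_mem' := by
    intro c a ha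
    simp only [Set.mem_ofPred_eq, Pi.smul_apply] at *
    rw [ha, smul_zero]

/-- The inner product `⟨g₁, g₂⟩ = ∑_f g₁(f) g₂(f)` of `2`-forms. -/
def inner₂ (g₁ g₂ : G.TwoForm f₀) : ℝ := ∑ f, g₁.1 f * g₂.1 f

/-- The discrete exterior derivative from `1`-forms to `2`-forms: the circulation around the
face, set to `0` at the marked face. -/
def d : G.OneForm →ₗ[ℝ] G.TwoForm f₀ where
  toFun h := ⟨fun f => if f = f₀ then 0 else
      ∑ e, h e * ((if G.left e = f then 1 else 0) - (if G.right e = f then 1 else 0)), by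
    simp [TwoForm]⟩
  map_add' h h' := by
    ext f
    by_cases hf : f = f₀ <;> simp [hf, add_mul, Finset.sum_add_distrib]
  map_smul' c h := by
    ext f
    by_cases hf : f = f₀ <;> simp [hf, Finset.mul_sum, mul_assoc]

/-- The operator `d^* = -dᵗ` from `2`-forms to `1`-forms. -/
def dStar : G.TwoForm f₀ →ₗ[ℝ] G.OneForm where
  toFun g e := -(g.1 (G.left e) - g.1 (G.right e))
  map_add' g g' := by
    funext e
    simp only [Submodule.coe_add, Pi.add_apply]
    ring
  map_smul' c g := by
    funext e
    simp only [Submodule.coe_smul, Pi.smul_apply, smul_eq_mul, RingHom.id_apply]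
    ring

/-- The (negative definite) Laplacian `Δ = d d^* + d^* d` on `2`-forms; the second term vanishes,
since there `d = 0`. -/
def laplacian : G.TwoForm f₀ →ₗ[ℝ] G.TwoForm f₀ := G.d f₀ ∘ₗ G.dStar f₀

/-- `d^* = -dᵗ`. -/
theorem inner₂_d (h : G.OneForm) (g : G.TwoForm f₀) :
    G.inner₂ f₀ (G.d f₀ h) g = -∑ e, h e * G.dStar f₀ g e := by
  have hg : g.1 f₀ = 0 := g.2
  have h1 : ∀ f, (G.d f₀ h).1 f * g.1 f =
      ∑ e, h e * ((if G.left e = f then g.1 f else 0) - (if G.right e = f then g.1 f else 0)) := by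
    intro f
    by_cases hf : f = f₀
    · simp [d, hf, hg]
    · simp only [d, LinearMap.coe_mk, AddHom.coe_mk, if_neg hf, Finset.sum_mul]
      refine Finset.sum_congr rfl fun e _ => ?_
      split_ifs <;> ring
  simp only [inner₂, h1]
  rw [Finset.sum_comm, ← Finset.sum_neg_distrib]
  refine Finset.sum_congr rfl fun e _ => ?_
  rw [← Finset.mul_sum, Finset.sum_sub_distrib]
  simp only [Finset.sum_ite_eq, Finset.mem_univ, if_true, dStar, LinearMap.coe_mk, AddHom.coe_mk]
  ring

theorem inner₂_neg_laplacian (g : G.TwoForm f₀) :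
    G.inner₂ f₀ (-G.laplacian f₀ g) g = ∑ e, (G.dStar f₀ g e) ^ 2 := by
  have h := G.inner₂_d f₀ (G.dStar f₀ g) g
  have h2 : G.inner₂ f₀ (-G.laplacian f₀ g) g =
      -G.inner₂ f₀ (G.d f₀ (G.dStar f₀ g)) g := by
    simp [inner₂, laplacian]
  rw [h2, h, neg_neg]
  exact Finset.sum_congr rfl fun e _ => (sq _).symm

theorem laplacian_injective : Function.Injective (G.laplacian f₀) := by
  rw [← LinearMap.ker_eq_bot, LinearMap.ker_eq_bot']
  intro g hg
  have h := G.inner₂_neg_laplacian f₀ g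
  rw [hg] at h
  have h0 : ∑ e, (G.dStar f₀ g e) ^ 2 = 0 := by
    rw [← h]; simp [inner₂]
  have h1 : ∀ e, g.1 (G.left e) = g.1 (G.right e) := by
    intro e
    have := (Finset.sum_eq_zero_iff_of_nonneg (fun e _ => sq_nonneg _)).1 h0 e (Finset.mem_univ e)
    have h2 : G.dStar f₀ g e = 0 := by simpa using this
    simp only [dStar, LinearMap.coe_mk, AddHom.coe_mk] at h2
    linarith
  have h2 : ∀ f f', Relation.EqvGen (fun a b => ∃ e, G.left e = a ∧ G.right e = b) f f' →
      g.1 f = g.1 f' := by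
    intro f f' hff
    induction hff with
    | rel a b hab => obtain ⟨e, rfl, rfl⟩ := hab; exact h1 e
    | refl a => rfl
    | symm a b _ ih => exact ih.symm
    | trans a b c _ _ ih ih' => exact ih.trans ih'
  ext f
  have hroot : g.1 f₀ = 0 := g.2
  rw [h2 f f₀ (G.dual_connected f f₀), hroot]
  rfl

/-- The Laplacian on `2`-forms, as an invertible operator. -/
def laplacianEquiv : G.TwoForm f₀ ≃ₗ[ℝ] G.TwoForm f₀ :=
  LinearEquiv.ofInjectiveEndo (G.laplacian f₀) (G.laplacian_injective f₀)

/-- The inverse `Δ⁻¹` of the Laplacian on `2`-forms. -/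
def invLaplacian : G.TwoForm f₀ →ₗ[ℝ] G.TwoForm f₀ := (G.laplacianEquiv f₀).symm.toLinearMap

theorem laplacian_invLaplacian (g : G.TwoForm f₀) :
    G.laplacian f₀ (G.invLaplacian f₀ g) = g :=
  (G.laplacianEquiv f₀).apply_symm_apply g

/-- The quadratic form `⟨g, (-Δ)⁻¹ g⟩` on `2`-forms. -/
def greenForm (g : G.TwoForm f₀) : ℝ := G.inner₂ f₀ g (-G.invLaplacian f₀ g)

/-- The indicator `1_f` as a `2`-form (it is the zero form when `f` is the marked face). -/
def ind (f : G.F) : G.TwoForm f₀ :=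
  ⟨fun x => if x = f ∧ x ≠ f₀ then 1 else 0, by simp [TwoForm]⟩

/-! ### The Coulomb gas -/

/-- Integer-valued `2`-forms. -/
abbrev IntTwoForm : Type := {q : G.F → ℤ // q f₀ = 0}

variable {G} {f₀} in
/-- An integer-valued `2`-form seen as a `2`-form. -/
def IntTwoForm.toReal (q : G.IntTwoForm f₀) : G.TwoForm f₀ :=
  ⟨fun f => (q.1 f : ℝ), by simp [TwoForm, q.2]⟩

/-- The Coulomb gas on the faces, at inverse temperature `β`:
`P[q = Q] ∝ exp (-(β (2π)² / 2) ⟨Q, (-Δ)⁻¹ Q⟩)`. -/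
def coulombGas (β : ℝ) : Measure (G.IntTwoForm f₀) :=
  gibbs fun q => β * (2 * Real.pi) ^ 2 / 2 * G.greenForm f₀ q.toReal

/-- The expectation `E[exp (2iπ (Δ⁻¹q(f) - Δ⁻¹q(f')))]` under the Coulomb gas `q`. -/
def coulombCharFun (β : ℝ) (f f' : G.F) : ℂ :=
  ∫ q : G.IntTwoForm f₀, Complex.exp (2 * Complex.I * Real.pi *
    ((G.invLaplacian f₀ q.toReal).1 f - (G.invLaplacian f₀ q.toReal).1 f')) ∂(G.coulombGas f₀ β)

theorem sum_sq_le_greenForm (g : G.TwoForm f₀) :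
    ∑ f, (g.1 f) ^ 2 ≤ (Fintype.card G.F * Fintype.card G.E : ℝ) * G.greenForm f₀ g := by
  set u : G.TwoForm f₀ := -G.invLaplacian f₀ g with hu
  have hgu : g = -G.laplacian f₀ u := by
    rw [hu, map_neg, neg_neg, laplacian_invLaplacian]
  have h1 : G.greenForm f₀ g = ∑ e, (G.dStar f₀ u e) ^ 2 := by
    rw [← inner₂_neg_laplacian, ← hgu]; rfl
  rw [h1]
  have h2 : ∀ f, (g.1 f) ^ 2 ≤ Fintype.card G.E * ∑ e, (G.dStar f₀ u e) ^ 2 := by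
    intro f
    by_cases hf : f = f₀
    · have h0 : g.1 f₀ = 0 := g.2
      rw [hf, h0, zero_pow two_ne_zero]
      exact mul_nonneg (Nat.cast_nonneg _) (Finset.sum_nonneg fun _ _ => sq_nonneg _)
    · have h3 : g.1 f = ∑ e, -(G.dStar f₀ u e *
          ((if G.left e = f then 1 else 0) - (if G.right e = f then 1 else 0))) := by
        rw [hgu, Finset.sum_neg_distrib]
        simp [laplacian, d, hf]
      rw [h3]
      refine (sq_sum_le_card_mul_sum_sq).trans ?_
      rw [Finset.card_univ]
      refine mul_le_mul_of_nonneg_left (Finset.sum_le_sum fun e _ => ?_) (by positivity)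
      split_ifs <;> nlinarith [sq_nonneg (G.dStar f₀ u e)]
  calc ∑ f, (g.1 f) ^ 2 ≤ ∑ _f : G.F, Fintype.card G.E * ∑ e, (G.dStar f₀ u e) ^ 2 :=
        Finset.sum_le_sum fun f _ => h2 f
    _ = _ := by rw [Finset.sum_const, Finset.card_univ, nsmul_eq_mul, mul_assoc]

/-- The partition function of the Coulomb gas is finite. -/
theorem summable_coulombGas {β : ℝ} (hβ : 0 < β) :
    Summable fun q : G.IntTwoForm f₀ =>
      Real.exp (-(β * (2 * Real.pi) ^ 2 / 2 * G.greenForm f₀ q.toReal)) := by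
  set C : ℝ := Fintype.card G.F * Fintype.card G.E + 1 with hC
  have hC0 : 0 < C := by positivity
  set c : ℝ := β * (2 * Real.pi) ^ 2 / C with hc
  have hc0 : 0 < c := by positivity
  have h1 := summable_intGaussian 0 hc0
  have hpi : Summable fun q : G.F → ℤ => ∏ f, Real.exp (-(c / 2 * ((q f : ℝ) - 0) ^ 2)) := by
    refine summable_of_sum_le (c := ∏ _f : G.F, ∑' k : ℤ, Real.exp (-(c / 2 * ((k : ℝ) - 0) ^ 2)))
      (fun q => Finset.prod_nonneg fun _ _ => (Real.exp_pos _).le) fun s => ?_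
    calc ∑ q ∈ s, ∏ f, Real.exp (-(c / 2 * ((q f : ℝ) - 0) ^ 2))
        ≤ ∑ q ∈ Fintype.piFinset fun f => s.image fun q : G.F → ℤ => q f,
            ∏ f, Real.exp (-(c / 2 * (((q f : ℤ) : ℝ) - 0) ^ 2)) := by
          refine Finset.sum_le_sum_of_subset_of_nonneg (fun q hq => ?_)
            fun q _ _ => Finset.prod_nonneg fun _ _ => (Real.exp_pos _).le
          exact Fintype.mem_piFinset.2 fun f => Finset.mem_image_of_mem _ hq
      _ = ∏ f : G.F, ∑ k ∈ s.image fun q : G.F → ℤ => q f,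
            Real.exp (-(c / 2 * (((k : ℤ) : ℝ) - 0) ^ 2)) := by
          rw [Finset.prod_univ_sum]
      _ ≤ _ := Finset.prod_le_prod
          (fun f _ => Finset.sum_nonneg fun _ _ => (Real.exp_pos _).le)
          fun f _ => h1.sum_le_tsum _ fun _ _ => (Real.exp_pos _).le
  refine Summable.of_nonneg_of_le (fun _ => (Real.exp_pos _).le) (fun q => ?_)
    (hpi.comp_injective Subtype.val_injective)
  simp only [Function.comp, ← Real.exp_sum]
  rw [Real.exp_le_exp, Finset.sum_neg_distrib, neg_le_neg_iff, ← Finset.mul_sum]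
  have h2 := G.sum_sq_le_greenForm f₀ q.toReal
  have h3 : 0 ≤ G.greenForm f₀ q.toReal := by
    set u : G.TwoForm f₀ := -G.invLaplacian f₀ q.toReal with hu
    have hgu : q.toReal = -G.laplacian f₀ u := by
      rw [hu, map_neg, neg_neg, laplacian_invLaplacian]
    have : G.greenForm f₀ q.toReal = ∑ e, (G.dStar f₀ u e) ^ 2 := by
      rw [← inner₂_neg_laplacian, ← hgu]; rfl
    rw [this]; positivity
  have h4 : ∑ f, ((q.1 f : ℝ) - 0) ^ 2 ≤ C * G.greenForm f₀ q.toReal := by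
    have : ∑ f, ((q.1 f : ℝ) - 0) ^ 2 = ∑ f, (q.toReal.1 f) ^ 2 := by
      simp [IntTwoForm.toReal]
    rw [this, hC]
    linarith
  calc c / 2 * ∑ f, ((q.1 f : ℝ) - 0) ^ 2 ≤ c / 2 * (C * G.greenForm f₀ q.toReal) :=
        mul_le_mul_of_nonneg_left h4 (by positivity)
    _ = _ := by rw [hc]; field_simp

theorem isProbabilityMeasure_coulombGas {β : ℝ} (hβ : 0 < β) :
    IsProbabilityMeasure (G.coulombGas f₀ β) :=
  haveI : Nonempty (G.IntTwoForm f₀) := ⟨⟨0, rfl⟩⟩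
  isProbabilityMeasure_gibbs (G.summable_coulombGas f₀ hβ)

end SphereGraph

/-! ### The boxes with free and with zero boundary conditions -/

/-- The vertices `[-n, n]² ∩ ℤ²` of the box. -/
def box (n : ℕ) : Finset (ℤ × ℤ) := Finset.Icc (-n : ℤ) n ×ˢ Finset.Icc (-n : ℤ) n

/-- The nearest-neighbour edges of `ℤ²`, oriented to the right or upwards. The edge `(p, false)`
goes from `p` to `p + (1, 0)` and the edge `(p, true)` from `p` to `p + (0, 1)`. -/
abbrev LatticeEdge : Type := (ℤ × ℤ) × Bool

namespace LatticeEdge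

def src (e : LatticeEdge) : ℤ × ℤ := e.1

def tgt : LatticeEdge → ℤ × ℤ
  | (p, false) => (p.1 + 1, p.2)
  | (p, true) => (p.1, p.2 + 1)

/-- The lower left corner of the unit square on the left of the edge. -/
def leftSquare : LatticeEdge → ℤ × ℤ
  | (p, false) => p
  | (p, true) => (p.1 - 1, p.2)

/-- The lower left corner of the unit square on the right of the edge. -/
def rightSquare : LatticeEdge → ℤ × ℤ
  | (p, false) => (p.1, p.2 - 1)
  | (p, true) => p

end LatticeEdge

/-- The edges of `ℤ²` with both ends in `[-n, n]²`. -/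
def freeEdges (n : ℕ) : Finset LatticeEdge :=
  (box n ×ˢ Finset.univ).filter fun e => e.src ∈ box n ∧ e.tgt ∈ box n

/-- The unit squares with all corners in `[-n, n]²`, given by their lower left corners. -/
def freeSquares (n : ℕ) : Finset (ℤ × ℤ) :=
  (box n).filter fun p => (p.1 + 1, p.2 + 1) ∈ box n

/-- The face of the graph with free boundary conditions that contains a given unit square: the
square itself if it lies in the box, and otherwise the face `none` containing `∞`. -/
def freeFace (n : ℕ) (p : ℤ × ℤ) : Option (freeSquares n) :=
  if h : p ∈ freeSquares n then some ⟨p, h⟩ else none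

/-- Free boundary conditions: the subgraph of `ℤ²` with vertices `[-n, n]²`, drawn on the sphere.
Its faces are the unit squares of the box and the outer face. -/
def freeBox (n : ℕ) : SphereGraph where
  E := freeEdges n
  F := Option (freeSquares n)
  left e := freeFace n e.1.leftSquare
  right e := freeFace n e.1.rightSquare
  dual_connected := by
    set R : Option (freeSquares n) → Option (freeSquares n) → Prop := fun a b =>
      ∃ e : freeEdges n, freeFace n e.1.leftSquare = a ∧ freeFace n e.1.rightSquare = b with hR
    have key : ∀ (k : ℕ) (y : ℤ),
        Relation.EqvGen R (freeFace n (-n - 1 + k, y)) none := by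
      intro k y
      induction k with
      | zero =>
        have : freeFace n (-n - 1 + (0 : ℕ), y) = none := by
          refine dif_neg ?_
          simp [freeSquares, box]
        rw [this]
        exact Relation.EqvGen.refl _
      | succ k ih =>
        by_cases hm : ((-n - 1 + (k + 1 : ℕ), y) : ℤ × ℤ) ∈ freeSquares n
        · refine Relation.EqvGen.trans _ _ _ (Relation.EqvGen.symm _ _
            (Relation.EqvGen.rel _ _ ?_)) ih
          refine ⟨⟨((-n - 1 + (k + 1 : ℕ), y), true), ?_⟩, ?_, ?_⟩
          · simp only [freeSquares, freeEdges, box, LatticeEdge.src, LatticeEdge.tgt,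
              Finset.mem_filter, Finset.mem_product, Finset.mem_Icc, Finset.mem_univ, and_true] at hm ⊢
            omega
          · simp only [LatticeEdge.leftSquare]
            congr 2
            push_cast
            ring
          · rfl
        · have : freeFace n (-n - 1 + (k + 1 : ℕ), y) = none := dif_neg hm
          rw [this]
          exact Relation.EqvGen.refl _
    have key2 : ∀ f, Relation.EqvGen R f none := by
      intro f
      rcases f with _ | ⟨⟨x, y⟩, hp⟩
      · exact Relation.EqvGen.refl _
      · have hx : -(n : ℤ) ≤ x := by
          simp only [freeSquares, box, Finset.mem_filter, Finset.mem_product,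
            Finset.mem_Icc] at hp
          omega
        have h := key (x + n + 1).toNat y
        have e : (-n - 1 + ((x + n + 1).toNat : ℤ) : ℤ) = x := by omega
        rw [e] at h
        rwa [freeFace, dif_pos hp] at h
    intro f f'
    exact Relation.EqvGen.trans _ _ _ (key2 f) (Relation.EqvGen.symm _ _ (key2 f'))

/-- The edges of `ℤ²` with at least one end in `[-n, n]²`. -/
def zeroEdges (n : ℕ) : Finset LatticeEdge :=
  (box (n + 1) ×ˢ Finset.univ).filter fun e => e.src ∈ box n ∨ e.tgt ∈ box n

/-- The unit squares with at least one corner in `[-n, n]²`, given by their lower left corners. -/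
def zeroSquares (n : ℕ) : Finset (ℤ × ℤ) :=
  (box (n + 1)).filter fun p =>
    p ∈ box n ∨ (p.1 + 1, p.2) ∈ box n ∨ (p.1, p.2 + 1) ∈ box n ∨ (p.1 + 1, p.2 + 1) ∈ box n

theorem mem_zeroSquares {n : ℕ} {p : ℤ × ℤ} : p ∈ zeroSquares n ↔
    (-(n : ℤ) - 1 ≤ p.1 ∧ p.1 ≤ n) ∧ (-(n : ℤ) - 1 ≤ p.2 ∧ p.2 ≤ n) := by
  simp only [zeroSquares, box, Finset.mem_filter, Finset.mem_product, Finset.mem_Icc]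
  push_cast
  omega

theorem mem_zeroEdges_horizontal {n : ℕ} {p : ℤ × ℤ} : (p, false) ∈ zeroEdges n ↔
    (-(n : ℤ) - 1 ≤ p.1 ∧ p.1 ≤ n) ∧ (-(n : ℤ) ≤ p.2 ∧ p.2 ≤ n) := by
  simp only [zeroEdges, box, Finset.mem_filter, Finset.mem_product, Finset.mem_Icc,
    LatticeEdge.src, LatticeEdge.tgt, Finset.mem_univ, and_true]
  push_cast
  omega

theorem mem_zeroEdges_vertical {n : ℕ} {p : ℤ × ℤ} : (p, true) ∈ zeroEdges n ↔
    (-(n : ℤ) ≤ p.1 ∧ p.1 ≤ n) ∧ (-(n : ℤ) - 1 ≤ p.2 ∧ p.2 ≤ n) := by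
  simp only [zeroEdges, box, Finset.mem_filter, Finset.mem_product, Finset.mem_Icc,
    LatticeEdge.src, LatticeEdge.tgt, Finset.mem_univ, and_true]
  push_cast
  omega

theorem leftSquare_mem_zeroSquares {n : ℕ} (e : zeroEdges n) :
    e.1.leftSquare ∈ zeroSquares n := by
  obtain ⟨⟨p, b⟩, he⟩ := e
  cases b
  · rw [mem_zeroEdges_horizontal] at he
    simp only [LatticeEdge.leftSquare, mem_zeroSquares]
    omega
  · rw [mem_zeroEdges_vertical] at he
    simp only [LatticeEdge.leftSquare, mem_zeroSquares]
    omega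

theorem rightSquare_mem_zeroSquares {n : ℕ} (e : zeroEdges n) :
    e.1.rightSquare ∈ zeroSquares n := by
  obtain ⟨⟨p, b⟩, he⟩ := e
  cases b
  · rw [mem_zeroEdges_horizontal] at he
    simp only [LatticeEdge.rightSquare, mem_zeroSquares]
    omega
  · rw [mem_zeroEdges_vertical] at he
    simp only [LatticeEdge.rightSquare, mem_zeroSquares]
    omega

/-- Zero boundary conditions: the graph with vertices `[-n, n]² ∪ {∞}`, obtained from `ℤ²` by
gluing all the vertices outside the box to `∞` and dropping the loops at `∞`, drawn on the sphere.
Its faces correspond to the unit squares that touch the box. It is the planar dual of a box graph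
with free boundary conditions. -/
def zeroBox (n : ℕ) : SphereGraph where
  E := zeroEdges n
  F := zeroSquares n
  left e := ⟨e.1.leftSquare, leftSquare_mem_zeroSquares e⟩
  right e := ⟨e.1.rightSquare, rightSquare_mem_zeroSquares e⟩
  dual_connected := by
    set R : zeroSquares n → zeroSquares n → Prop := fun a b => ∃ e : zeroEdges n,
      (⟨e.1.leftSquare, leftSquare_mem_zeroSquares e⟩ : zeroSquares n) = a ∧
      (⟨e.1.rightSquare, rightSquare_mem_zeroSquares e⟩ : zeroSquares n) = b with hR
    have h00 : ((-(n : ℤ) - 1, -(n : ℤ) - 1) : ℤ × ℤ) ∈ zeroSquares n := by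
      rw [mem_zeroSquares]; dsimp only; omega
    have key1 : ∀ (l : ℕ) (h : ((-(n : ℤ) - 1, -(n : ℤ) - 1 + l) : ℤ × ℤ) ∈ zeroSquares n),
        Relation.EqvGen R ⟨_, h⟩ ⟨_, h00⟩ := by
      intro l
      induction l with
      | zero =>
        intro h
        have : (⟨_, h⟩ : zeroSquares n) = ⟨_, h00⟩ := by simp
        rw [this]
        exact Relation.EqvGen.refl _
      | succ l ih =>
        intro h
        have hm := mem_zeroSquares.1 h
        dsimp only at hm
        have h' : ((-(n : ℤ) - 1, -(n : ℤ) - 1 + l) : ℤ × ℤ) ∈ zeroSquares n := by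
          rw [mem_zeroSquares]; dsimp only; omega
        refine Relation.EqvGen.trans _ _ _ (Relation.EqvGen.rel _ _ ?_) (ih h')
        refine ⟨⟨((-(n : ℤ) - 1, -(n : ℤ) - 1 + (l + 1 : ℕ)), false), ?_⟩, ?_, ?_⟩
        · rw [mem_zeroEdges_horizontal]; dsimp only; omega
        · rfl
        · simp only [LatticeEdge.rightSquare, Subtype.mk.injEq, Prod.mk.injEq, true_and]
          push_cast
          ring
    have key : ∀ (k : ℕ) (y : ℤ) (h : ((-(n : ℤ) - 1 + k, y) : ℤ × ℤ) ∈ zeroSquares n),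
        Relation.EqvGen R ⟨_, h⟩ ⟨_, h00⟩ := by
      intro k y
      induction k with
      | zero =>
        intro h
        have hm := mem_zeroSquares.1 h
        dsimp only at hm
        have e : (-(n : ℤ) - 1 + ((y + n + 1).toNat : ℤ) : ℤ) = y := by omega
        have h' : ((-(n : ℤ) - 1, -(n : ℤ) - 1 + ((y + n + 1).toNat : ℤ)) : ℤ × ℤ)
            ∈ zeroSquares n := by
          rw [e, mem_zeroSquares]; dsimp only; omega
        have h2 := key1 _ h'
        have e2 : (⟨_, h⟩ : zeroSquares n) = ⟨_, h'⟩ := by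
          rw [Subtype.mk.injEq, Prod.mk.injEq, e]
          exact ⟨by simp, rfl⟩
        rw [e2]
        exact h2
      | succ k ih =>
        intro h
        have hm := mem_zeroSquares.1 h
        dsimp only at hm
        have h' : ((-(n : ℤ) - 1 + k, y) : ℤ × ℤ) ∈ zeroSquares n := by
          rw [mem_zeroSquares]; dsimp only; omega
        refine Relation.EqvGen.trans _ _ _ (Relation.EqvGen.symm _ _
          (Relation.EqvGen.rel _ _ ?_)) (ih h')
        refine ⟨⟨((-(n : ℤ) - 1 + (k + 1 : ℕ), y), true), ?_⟩, ?_, ?_⟩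
        · rw [mem_zeroEdges_vertical]; dsimp only; omega
        · simp only [LatticeEdge.leftSquare, Subtype.mk.injEq, Prod.mk.injEq, and_true]
          push_cast
          ring
        · rfl
    have key2 : ∀ f, Relation.EqvGen R f ⟨_, h00⟩ := by
      rintro ⟨⟨x, y⟩, hp⟩
      have hm := mem_zeroSquares.1 hp
      dsimp only at hm
      have e : (-(n : ℤ) - 1 + ((x + n + 1).toNat : ℤ) : ℤ) = x := by omega
      have h' : ((-(n : ℤ) - 1 + ((x + n + 1).toNat : ℤ), y) : ℤ × ℤ) ∈ zeroSquares n := by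
        rw [e]; exact hp
      have e2 : (⟨_, hp⟩ : zeroSquares n) = ⟨_, h'⟩ := by
        simp only [e]
      rw [e2]
      exact key _ _ h'
    intro f f'
    exact Relation.EqvGen.trans _ _ _ (key2 f) (Relation.EqvGen.symm _ _ (key2 f'))

/-- The two boundary conditions. -/
inductive BoundaryCondition
  | free
  | zero

/-- The graph `Λ_n` with the given boundary condition. -/
def boxGraph : BoundaryCondition → ℕ → SphereGraph
  | .free, n => freeBox n
  | .zero, n => zeroBox n

end Coulomb

end

/-! Write `b = (2π)²β`. The Coulomb gas is realised as the exterior derivative of independent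
integer-valued Gaussians on the edges. For a closed `1`-form `Py`, give an integer `1`-form `m` the
weight `exp(-(b/2)‖m - Py‖²)`. Splitting `m` into `q = dm` and a closed integer form `z` and using
the orthogonality of closed forms to the range of `d^*`, the energy becomes `⟨q, (-Δ)⁻¹q⟩` plus the
squared distance from `z` to a closed form that depends on `q` and `y` (`sum_sq_sub_proj`). Summing
over `z` leaves the Coulomb weight of `q` times a theta function of the lattice of closed integer
forms, evaluated at `y` translated by a vector depending on `q`. This theta function is periodic
under all integer `1`-forms, so averaging `y` over the unit cube turns it into a constant and leaves
exactly the Coulomb gas (`norm_tsum_coulomb_le`). It therefore suffices to bound the observable for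
each fixed `y`.

For fixed `y` the observable is linear in `m`: with `h = d^*Δ⁻¹(1_f - 1_f')`, the difference
`Δ⁻¹q(f) - Δ⁻¹q(f')` equals `-⟨m, h⟩`. The expectation thus factorises into one-dimensional
characteristic functions at `h_e`, and `∑ h_e²` is the Green form on the right-hand side. What is
needed is a Gaussian bound `exp(-(v/4)h_e²)` for each factor, with `v` the minimal variance
(`norm_igFourier_le`).

Such a bound cannot hold for every `h_e`, because the modulus of the characteristic function is `1`
at every integer. It holds for `|h_e| ≤ 3/4`, and this is guaranteed by electrical considerations
(`abs_dStar_le`): `h` is a unit current flow on the dual graph, and every dual edge lies on a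
`4`-cycle, hence has effective resistance at most `3/4`. For `b ≥ 12` the variance is carried by the
atoms near `0`, so comparing the variance and the characteristic function with the mass at `1` is
accurate enough to give the constant `1/4`, and `K = 1` works. -/

noncomputable section

namespace Coulomb

/-! ### One-dimensional integer-valued Gaussian sums -/

/-- The weight of the integer-valued Gaussian variable. -/
def igWeight (a b : ℝ) (k : ℤ) : ℝ := Real.exp (-(b / 2 * ((k : ℝ) - a) ^ 2))

theorem igWeight_pos (a b : ℝ) (k : ℤ) : 0 < igWeight a b k := Real.exp_pos _

theorem summable_igWeight (a : ℝ) {b : ℝ} (hb : 0 < b) : Summable (igWeight a b) :=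
  summable_intGaussian a hb

/-- The integral of a function under a discrete Gibbs measure. -/
theorem integral_gibbs {α : Type} [MeasurableSpace α] [MeasurableSingletonClass α] [Countable α]
    {E : Type*} [NormedAddCommGroup E] [NormedSpace ℝ E] [CompleteSpace E] {H : α → ℝ}
    (hH : Summable fun a => Real.exp (-H a)) {f : α → E}
    (hf : Summable fun a => Real.exp (-H a) * ‖f a‖) :
    ∫ a, f a ∂gibbs H = (∑' a, Real.exp (-H a))⁻¹ • ∑' a, Real.exp (-H a) • f a := by
  have hs : ∀ a, (Measure.sum fun a => ENNReal.ofReal (Real.exp (-H a)) • Measure.dirac a) {a} =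
      ENNReal.ofReal (Real.exp (-H a)) := by
    intro a
    rw [Measure.sum_apply _ (measurableSet_singleton a), tsum_eq_single a]
    · simp
    · intro b hb
      simp [hb]
  have hint : Integrable f
      (Measure.sum fun a => ENNReal.ofReal (Real.exp (-H a)) • Measure.dirac a) := by
    refine integrable_sum_dirac (fun a => ENNReal.ofReal_lt_top.ne) ?_
    refine hf.congr fun a => ?_
    rw [ENNReal.toReal_ofReal (Real.exp_pos _).le]
  rw [gibbs, integral_smul_measure, integral_countable hint]
  congr 1
  · rw [ENNReal.toReal_inv, ← ENNReal.ofReal_tsum_of_nonneg (fun _ => (Real.exp_pos _).le) hH,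
      ENNReal.toReal_ofReal (tsum_nonneg fun _ => (Real.exp_pos _).le)]
  · refine tsum_congr fun a => ?_
    rw [measureReal_def, hs, ENNReal.toReal_ofReal (Real.exp_pos _).le]

theorem igWeight_le_of_sq_le {a b : ℝ} (hb : 0 ≤ b) {k l : ℤ} {c : ℝ}
    (h : ((l : ℝ) - a) ^ 2 + c ≤ ((k : ℝ) - a) ^ 2) :
    igWeight a b k ≤ igWeight a b l * Real.exp (-(b / 2 * c)) := by
  rw [igWeight, igWeight, ← Real.exp_add, Real.exp_le_exp]
  nlinarith [mul_le_mul_of_nonneg_left h (by positivity : 0 ≤ b / 2)]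

theorem sq_mul_exp_le {j : ℕ} : (j : ℝ) ^ 2 * Real.exp (-(6 * j)) ≤ (1 / 8) ^ j := by
  have h1 : (j : ℝ) + 1 ≤ Real.exp j := Real.add_one_le_exp _
  have h2 : (2 : ℝ) ≤ Real.exp 1 := by linarith [Real.add_one_le_exp (1 : ℝ)]
  have h3 : (j : ℝ) ^ 2 ≤ Real.exp j ^ 2 := by
    gcongr
    linarith
  have h4 : Real.exp (-(3 * j)) ≤ (1 / 8) ^ j := by
    have : Real.exp (-(3 * (j : ℝ))) = (Real.exp (-3)) ^ j := by
      rw [← Real.exp_nat_mul]; ring_nf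
    rw [this]
    gcongr
    have : Real.exp 3 = Real.exp 1 ^ 3 := by rw [← Real.exp_nat_mul]; norm_num
    rw [Real.exp_neg, this, one_div]
    gcongr
    calc (8 : ℝ) = 2 ^ 3 := by norm_num
      _ ≤ _ := by gcongr
  calc (j : ℝ) ^ 2 * Real.exp (-(6 * j)) ≤ Real.exp j ^ 2 * Real.exp (-(6 * j)) := by gcongr
    _ = Real.exp (-(4 * j)) := by
      rw [← Real.exp_nat_mul, ← Real.exp_add]; push_cast; ring_nf
    _ ≤ Real.exp (-(3 * j)) := by
      rw [Real.exp_le_exp]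
      have : (0 : ℝ) ≤ j := Nat.cast_nonneg _
      linarith
    _ ≤ _ := h4

/-- A termwise bound for the second moment about `0`, to which the atom at `0` contributes nothing.
The atoms at `1` and `-1` weigh at most the atom at `1`, and the remaining ones are geometrically
small because `b ≥ 12`. -/
theorem sq_mul_igWeight_le {a b : ℝ} (ha0 : 0 ≤ a) (ha : a ≤ 1 / 2) (hb : 12 ≤ b) (k : ℤ) :
    (k : ℝ) ^ 2 * igWeight a b k ≤
      igWeight a b 1 * ((if k = 1 ∨ k = -1 then 1 else 0) + (1 / 8) ^ k.natAbs) := by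
  have hw := igWeight_pos a b 1
  by_cases hk : k = 1 ∨ k = -1
  · rw [if_pos hk]
    have h1 : igWeight a b k ≤ igWeight a b 1 := by
      have := igWeight_le_of_sq_le (a := a) (b := b) (by linarith) (k := k) (l := 1) (c := 0) (by
        rcases hk with rfl | rfl <;> push_cast <;> nlinarith)
      simpa using this
    have h2 : (k : ℝ) ^ 2 = 1 := by rcases hk with rfl | rfl <;> norm_num
    rw [h2, one_mul, mul_add, mul_one]
    have : 0 ≤ igWeight a b 1 * (1 / 8) ^ k.natAbs := by positivity
    linarith
  · rw [if_neg hk, zero_add]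
    by_cases hk0 : k = 0
    · subst hk0
      simpa using hw.le
    have hj : 2 ≤ k.natAbs := by omega
    set j := k.natAbs with hjdef
    have hj' : (2 : ℝ) ≤ j := by exact_mod_cast hj
    have hkj : (k : ℝ) = j ∨ (k : ℝ) = -j := by
      rcases Int.natAbs_eq k with h | h
      · left; rw [h]; push_cast; simp [hjdef]
      · right; rw [h]; push_cast; simp [hjdef]
    -- For `j ≥ 2` and `0 ≤ a ≤ 1/2`, `(j - a)² - (1 - a)² ≥ j² - j ≥ j`, and `-j` is further still
    -- from `a`.
    have h1 := igWeight_le_of_sq_le (a := a) (b := b) (by linarith) (k := k) (l := 1) (c := j) (by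
      push_cast
      rcases hkj with h | h <;> rw [h] <;> nlinarith)
    have h2 : (k : ℝ) ^ 2 = (j : ℝ) ^ 2 := by rcases hkj with h | h <;> rw [h]; ring
    calc (k : ℝ) ^ 2 * igWeight a b k
        ≤ (j : ℝ) ^ 2 * (igWeight a b 1 * Real.exp (-(b / 2 * j))) := by rw [h2]; gcongr
      _ ≤ (j : ℝ) ^ 2 * (igWeight a b 1 * Real.exp (-(6 * j))) := by
        gcongr
        linarith
      _ = igWeight a b 1 * ((j : ℝ) ^ 2 * Real.exp (-(6 * j))) := by ring
      _ ≤ _ := by gcongr; exact sq_mul_exp_le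

theorem hasSum_pow_natAbs : HasSum (fun k : ℤ => (1 / 8 : ℝ) ^ k.natAbs) (9 / 7) := by
  have h : HasSum (fun n : ℕ => (1 / 8 : ℝ) ^ n) (8 / 7) := by
    have := hasSum_geometric_of_lt_one (r := (1 / 8 : ℝ)) (by norm_num) (by norm_num)
    have e : (1 - 1 / 8 : ℝ)⁻¹ = 8 / 7 := by norm_num
    rwa [e] at this
  have h1 : HasSum (fun n : ℕ => (1 / 8 : ℝ) ^ ((n : ℤ)).natAbs) (8 / 7) := by
    simpa only [Int.natAbs_natCast] using h
  have h2 : HasSum (fun n : ℕ => (1 / 8 : ℝ) ^ (-((n : ℤ) + 1)).natAbs) (1 / 8 * (8 / 7)) := by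
    have e : ∀ n : ℕ, (1 / 8 : ℝ) ^ (-((n : ℤ) + 1)).natAbs = 1 / 8 * (1 / 8) ^ n := by
      intro n
      have : (-((n : ℤ) + 1)).natAbs = n + 1 := by omega
      rw [this, pow_succ']
    simp only [e]
    exact h.mul_left (1 / 8)
  have h3 := HasSum.of_nat_of_neg_add_one (f := fun k : ℤ => (1 / 8 : ℝ) ^ k.natAbs) h1 h2
  have e : (8 / 7 + 1 / 8 * (8 / 7) : ℝ) = 9 / 7 := by norm_num
  rwa [e] at h3

theorem hasSum_indicator_pm_one :
    HasSum (fun k : ℤ => if k = 1 ∨ k = -1 then (1 : ℝ) else 0) 2 := by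
  have h : HasSum (fun k : ℤ => if k = 1 ∨ k = -1 then (1 : ℝ) else 0)
      (∑ k ∈ ({1, -1} : Finset ℤ), if k = 1 ∨ k = -1 then (1 : ℝ) else 0) :=
    hasSum_sum_of_ne_finset_zero fun k hk => by
      rw [if_neg]
      simpa using hk
  have e : ∑ k ∈ ({1, -1} : Finset ℤ), (if k = 1 ∨ k = -1 then (1 : ℝ) else 0) = 2 := by
    rw [Finset.sum_pair (by norm_num)]
    norm_num
  rwa [e] at h

theorem summable_sq_mul_igWeight {a b : ℝ} (ha0 : 0 ≤ a) (ha : a ≤ 1 / 2) (hb : 12 ≤ b) :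
    Summable fun k : ℤ => (k : ℝ) ^ 2 * igWeight a b k :=
  Summable.of_nonneg_of_le (fun k => mul_nonneg (sq_nonneg _) (igWeight_pos a b k).le)
    (sq_mul_igWeight_le ha0 ha hb)
    ((hasSum_indicator_pm_one.add hasSum_pow_natAbs).mul_left _).summable

theorem tsum_sq_mul_igWeight_le {a b : ℝ} (ha0 : 0 ≤ a) (ha : a ≤ 1 / 2) (hb : 12 ≤ b) :
    ∑' k : ℤ, (k : ℝ) ^ 2 * igWeight a b k ≤ igWeight a b 1 * (2 + 9 / 7) := by
  have h := (hasSum_indicator_pm_one.add hasSum_pow_natAbs).mul_left (igWeight a b 1)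
  rw [← h.tsum_eq]
  exact (summable_sq_mul_igWeight ha0 ha hb).tsum_le_tsum (sq_mul_igWeight_le ha0 ha hb) h.summable

theorem tsum_igWeight_pos (a : ℝ) {b : ℝ} (hb : 0 < b) : 0 < ∑' k, igWeight a b k :=
  (summable_igWeight a hb).tsum_pos (fun k => (igWeight_pos a b k).le) 0 (igWeight_pos a b 0)

/-- The variance of an integer-valued Gaussian is controlled by its mass at `1`. -/
theorem varIG_mul_tsum_le {a b : ℝ} (ha0 : 0 ≤ a) (ha : a ≤ 1 / 2) (hb : 12 ≤ b) :
    varIG a b * ∑' k, igWeight a b k ≤ igWeight a b 1 * (2 + 9 / 7) := by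
  have hb0 : 0 < b := by linarith
  have := isProbabilityMeasure_intGaussian a hb0
  have hZ := tsum_igWeight_pos a hb0
  -- The variance is at most the second moment about `0`.
  have h1 : varIG a b ≤ ∫ k : ℤ, (k : ℝ) ^ 2 ∂intGaussian a b := by
    refine (variance_le_expectation_sq ?_).trans (le_of_eq ?_)
    · exact Measurable.aestronglyMeasurable (by fun_prop)
    · simp
  have h2 : ∫ k : ℤ, (k : ℝ) ^ 2 ∂intGaussian a b =
      (∑' k, igWeight a b k)⁻¹ * ∑' k : ℤ, (k : ℝ) ^ 2 * igWeight a b k := by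
    rw [intGaussian, integral_gibbs (summable_intGaussian a hb0)]
    · simp only [smul_eq_mul]
      congr 1
      exact tsum_congr fun k => mul_comm _ _
    · refine (summable_sq_mul_igWeight ha0 ha hb).congr fun k => ?_
      rw [mul_comm, Real.norm_of_nonneg (sq_nonneg _)]
      rfl
  rw [h2] at h1
  calc varIG a b * ∑' k, igWeight a b k
      ≤ ((∑' k, igWeight a b k)⁻¹ * ∑' k : ℤ, (k : ℝ) ^ 2 * igWeight a b k) *
          ∑' k, igWeight a b k := by gcongr
    _ = ∑' k : ℤ, (k : ℝ) ^ 2 * igWeight a b k := by field_simp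
    _ ≤ _ := tsum_sq_mul_igWeight_le ha0 ha hb

/-! ### Gaussian bounds for the characteristic function of an integer-valued Gaussian -/

theorem sq_le_one_sub_cos {h : ℝ} (hh : |h| ≤ 3 / 4) :
    16 / 9 * h ^ 2 ≤ 1 - Real.cos (2 * Real.pi * h) := by
  have key : ∀ x : ℝ, 0 ≤ x → x ≤ 3 / 4 → 16 / 9 * x ^ 2 ≤ 1 - Real.cos (2 * Real.pi * x) := by
    intro x hx0 hx
    have hpi := Real.pi_pos
    rcases le_total x (1 / 2) with h2 | h2
    -- Up to `1/2`, Jordan's inequality gives the stronger bound `8x²`.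
    · have h3 := Real.mul_le_sin (x := Real.pi * x) (by positivity) (by nlinarith)
      have h4 : 2 / Real.pi * (Real.pi * x) = 2 * x := by field_simp
      rw [h4] at h3
      have h5 : Real.cos (2 * Real.pi * x) = 1 - 2 * Real.sin (Real.pi * x) ^ 2 := by
        rw [mul_assoc, Real.cos_two_mul, Real.cos_sq']; ring
      rw [h5]
      nlinarith [pow_le_pow_left₀ (by positivity) h3 2]
    -- On `[1/2, 3/4]` the cosine is nonpositive and `16/9 * x² ≤ 1`, with equality at `3/4`: this
    -- fixes the constant `16/9`.
    · have h3 : Real.cos (2 * Real.pi * x) ≤ 0 :=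
        Real.cos_nonpos_of_pi_div_two_le_of_le (by nlinarith) (by nlinarith)
      nlinarith
  rcases le_total 0 h with h0 | h0
  · exact key h h0 (by rwa [abs_of_nonneg h0] at hh)
  · have := key (-h) (by linarith) (by rwa [abs_of_nonpos h0] at hh)
    rwa [neg_sq, mul_neg, Real.cos_neg] at this

/-- The squared modulus is `(p + q)² - 2pq(1 - cos θ)`. The square of the right-hand side exceeds it
by `q(p - q)(1 - cos θ) + (q(1 - cos θ)/2)²`, which is nonnegative since `q ≤ p`. -/
theorem norm_add_mul_exp_le {p q θ : ℝ} (hq : 0 ≤ q) (hpq : q ≤ p) :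
    ‖(p : ℂ) + q * Complex.exp (θ * Complex.I)‖ ≤ p + q - q * (1 - Real.cos θ) / 2 := by
  have hc := Real.neg_one_le_cos θ
  have hc' := Real.cos_le_one θ
  refine abs_le_of_sq_le_sq' ?_ (by nlinarith) |>.2
  rw [Complex.sq_norm, Complex.normSq_apply, Complex.exp_mul_I]
  have e1 : ((p : ℂ) + q * (Complex.cos θ + Complex.sin θ * Complex.I)).re = p + q * Real.cos θ := by
    simp [Complex.cos_ofReal_re, Complex.sin_ofReal_im]
  have e2 : ((p : ℂ) + q * (Complex.cos θ + Complex.sin θ * Complex.I)).im = q * Real.sin θ := by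
    simp [Complex.cos_ofReal_im, Complex.sin_ofReal_re]
  rw [e1, e2]
  have hs : Real.sin θ * Real.sin θ = 1 - Real.cos θ ^ 2 := by
    linarith [Real.sin_sq_add_cos_sq θ, sq (Real.sin θ)]
  have e3 : q * Real.sin θ * (q * Real.sin θ) = q ^ 2 * (1 - Real.cos θ ^ 2) := by
    rw [← hs]; ring
  have h1 : 0 ≤ q * (1 - Real.cos θ) * (p - q) :=
    mul_nonneg (mul_nonneg hq (sub_nonneg.2 hc')) (sub_nonneg.2 hpq)
  rw [e3]
  linarith [sq_nonneg (q * (1 - Real.cos θ) / 2)]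

/-- The unnormalised characteristic function of the integer-valued Gaussian. -/
def igFourier (a b h : ℝ) : ℂ :=
  ∑' k : ℤ, (igWeight a b k : ℂ) * Complex.exp ((2 * Real.pi * h * k : ℝ) * Complex.I)

theorem norm_igFourier_term (a b h : ℝ) (k : ℤ) :
    ‖(igWeight a b k : ℂ) * Complex.exp ((2 * Real.pi * h * k : ℝ) * Complex.I)‖ =
      igWeight a b k := by
  rw [norm_mul, Complex.norm_exp_ofReal_mul_I, mul_one, Complex.norm_real,
    Real.norm_of_nonneg (igWeight_pos a b k).le]

theorem summable_igFourier (a h : ℝ) {b : ℝ} (hb : 0 < b) : Summable fun k : ℤ =>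
    ‖(igWeight a b k : ℂ) * Complex.exp ((2 * Real.pi * h * k : ℝ) * Complex.I)‖ :=
  (summable_igWeight a hb).congr fun k => (norm_igFourier_term a b h k).symm

/-- The cancellation between the two atoms `0` and `1` alone is enough; all other atoms are
estimated by their mass. As `a ≤ 1/2`, the atom at `0` is the heavier one. -/
theorem norm_igFourier_le_sub {a b h : ℝ} (ha : a ≤ 1 / 2) (hb : 0 < b) :
    ‖igFourier a b h‖ ≤
      ∑' k, igWeight a b k - igWeight a b 1 * (1 - Real.cos (2 * Real.pi * h)) / 2 := by
  have hs := (summable_igFourier a h hb)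
  have h1 := hs.of_norm.sum_add_tsum_compl (s := {0, 1})
  have h2 := (summable_igWeight a hb).sum_add_tsum_compl (s := {0, 1})
  rw [Finset.sum_pair (by norm_num)] at h1 h2
  have h3 : igWeight a b 1 ≤ igWeight a b 0 := by
    have := igWeight_le_of_sq_le (a := a) hb.le (k := 1) (l := 0) (c := 0) (by
      push_cast; nlinarith)
    simpa using this
  have h4 := norm_add_mul_exp_le (θ := 2 * Real.pi * h) (igWeight_pos a b 1).le h3
  rw [igFourier, ← h1, ← h2]
  refine (norm_add_le _ _).trans ?_
  have e : (2 * Real.pi * h * ((0 : ℤ) : ℝ) : ℝ) = 0 := by simp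
  have e' : (2 * Real.pi * h * ((1 : ℤ) : ℝ) : ℝ) = 2 * Real.pi * h := by simp
  rw [e, e']
  simp only [Complex.ofReal_zero, zero_mul, Complex.exp_zero, mul_one]
  rw [add_sub_right_comm]
  refine add_le_add h4 ((norm_tsum_le_tsum_norm (hs.subtype _)).trans (le_of_eq ?_))
  exact tsum_congr fun k => norm_igFourier_term a b h k

/-- Translating the centre by an integer only multiplies the sum by a phase. -/
theorem norm_igFourier_add_int (a b h : ℝ) (n : ℤ) :
    ‖igFourier (a + n) b h‖ = ‖igFourier a b h‖ := by
  have : igFourier (a + n) b h =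
      Complex.exp ((2 * Real.pi * h * n : ℝ) * Complex.I) * igFourier a b h := by
    rw [igFourier, igFourier, ← tsum_mul_left, ← (Equiv.addRight n).tsum_eq]
    refine tsum_congr fun k => ?_
    simp only [Equiv.coe_addRight, igWeight]
    rw [mul_left_comm, ← Complex.exp_add]
    congr 2
    · push_cast; ring_nf
    · push_cast; ring_nf
  rw [this, norm_mul, Complex.norm_exp_ofReal_mul_I, one_mul]

theorem tsum_igWeight_add_int (a b : ℝ) (n : ℤ) :
    ∑' k, igWeight (a + n) b k = ∑' k, igWeight a b k := by
  rw [← (Equiv.addRight n).tsum_eq]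
  refine tsum_congr fun k => ?_
  simp only [Equiv.coe_addRight, igWeight]
  push_cast
  ring_nf

theorem igFourier_neg (a b h : ℝ) : igFourier (-a) b h = igFourier a b (-h) := by
  rw [igFourier, igFourier, ← (Equiv.neg ℤ).tsum_eq]
  refine tsum_congr fun k => ?_
  simp only [Equiv.neg_apply, igWeight]
  push_cast
  ring_nf

theorem tsum_igWeight_neg (a b : ℝ) : ∑' k, igWeight (-a) b k = ∑' k, igWeight a b k := by
  rw [← (Equiv.neg ℤ).tsum_eq]
  refine tsum_congr fun k => ?_
  simp only [Equiv.neg_apply, igWeight]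
  push_cast
  ring_nf

/-- The minimal variance of an integer-valued Gaussian. -/
def minVarIG (b : ℝ) : ℝ := sInf ((fun a : ℝ => varIG a b) '' Set.Icc 0 (1 / 2))

/-- A Gaussian bound for the characteristic function of the integer-valued Gaussian. -/
theorem norm_igFourier_le {b h : ℝ} (a : ℝ) (hb : 12 ≤ b) (hh : |h| ≤ 3 / 4) :
    ‖igFourier a b h‖ ≤ Real.exp (-(minVarIG b / 4 * h ^ 2)) * ∑' k, igWeight a b k := by
  have hb0 : 0 < b := by linarith
  have key : ∀ (a h : ℝ), 0 ≤ a → a ≤ 1 / 2 → |h| ≤ 3 / 4 →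
      ‖igFourier a b h‖ ≤ Real.exp (-(minVarIG b / 4 * h ^ 2)) * ∑' k, igWeight a b k := by
    intro a h ha0 ha hh
    have hZ := tsum_igWeight_pos a hb0
    have h1 : minVarIG b ≤ varIG a b := by
      refine csInf_le ⟨0, ?_⟩ ⟨a, ⟨ha0, ha⟩, rfl⟩
      rintro _ ⟨x, -, rfl⟩
      exact variance_nonneg _ _
    have h2 := varIG_mul_tsum_le ha0 ha hb
    have h3 := sq_le_one_sub_cos hh
    have h4 := norm_igFourier_le_sub (h := h) ha hb0
    have hw := igWeight_pos a b 1
    have h5 : minVarIG b * ∑' k, igWeight a b k ≤ igWeight a b 1 * (2 + 9 / 7) :=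
      (mul_le_mul_of_nonneg_right h1 hZ.le).trans h2
    have h6 := Real.add_one_le_exp (-(minVarIG b / 4 * h ^ 2))
    calc ‖igFourier a b h‖
        ≤ ∑' k, igWeight a b k - igWeight a b 1 * (16 / 9 * h ^ 2) / 2 := by
          refine h4.trans ?_
          gcongr
      -- The mass at `1` is at least `7/23` of the minimal variance times the total mass, and `7/23
      -- * 8/9 = 56/207 > 1/4`.
      _ ≤ (-(minVarIG b / 4 * h ^ 2) + 1) * ∑' k, igWeight a b k := by
          nlinarith [mul_le_mul_of_nonneg_right h5 (sq_nonneg h), mul_nonneg hw.le (sq_nonneg h)]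
      _ ≤ _ := by gcongr
  -- An integer translation, followed if necessary by a reflection, brings the centre into `[0,
  -- 1/2]`.
  set c := a - round a with hc
  have ha : a = c + (round a : ℤ) := by rw [hc]; ring
  have hc2 : |c| ≤ 1 / 2 := abs_sub_round a
  rw [ha, norm_igFourier_add_int, tsum_igWeight_add_int]
  rcases le_total 0 c with h0 | h0
  · exact key c h h0 (by rwa [abs_of_nonneg h0] at hc2) hh
  · have := key (-c) (-h) (by linarith) (by rwa [abs_of_nonpos h0] at hc2) (by rwa [abs_neg])
    rwa [← igFourier_neg, tsum_igWeight_neg, neg_neg, neg_sq] at this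

namespace SphereGraph

variable (G : SphereGraph) (f₀ : G.F)

/-! ### Integer sections of the exterior derivative -/

/-- The circulation of an integer `1`-form around a face. -/
def circ (m : G.E → ℤ) (f : G.F) : ℤ :=
  ∑ e, m e * ((if G.left e = f then 1 else 0) - (if G.right e = f then 1 else 0))

theorem circ_add (m m' : G.E → ℤ) (f : G.F) : G.circ (m + m') f = G.circ m f + G.circ m' f := by
  simp [circ, add_mul, Finset.sum_add_distrib]

theorem circ_neg (m : G.E → ℤ) (f : G.F) : G.circ (-m) f = -G.circ m f := by
  simp [circ]

/-- Crossing one edge changes the face and contributes circulation `1` and `-1` on its two sides; a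
chain of faces adds up telescopically. This makes `d` surjective over the integers, so that every
charge configuration lifts to an integer `1`-form. -/
theorem exists_circ_eq (f f' : G.F) : ∃ m : G.E → ℤ, ∀ x,
    G.circ m x = (if f = x then 1 else 0) - (if f' = x then 1 else 0) := by
  classical
  have h := G.dual_connected f f'
  induction h with
  | rel a b hab =>
    obtain ⟨e, rfl, rfl⟩ := hab
    refine ⟨Pi.single e 1, fun x => ?_⟩
    rw [circ, Finset.sum_eq_single e]
    · simp
    · intro e' _ he
      simp [he]
    · simp
  | refl a => exact ⟨0, fun x => by simp [circ]⟩
  | symm a b _ ih =>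
    obtain ⟨m, hm⟩ := ih
    exact ⟨-m, fun x => by rw [circ_neg, hm]; ring⟩
  | trans a b c _ _ ih ih' =>
    obtain ⟨m, hm⟩ := ih
    obtain ⟨m', hm'⟩ := ih'
    exact ⟨m + m', fun x => by rw [circ_add, hm, hm']; ring⟩

/-- An integer `1`-form with circulation `1` around `f` and `-1` around `f₀`. -/
def pathForm (f : G.F) : G.E → ℤ := (G.exists_circ_eq f f₀).choose

theorem circ_pathForm (f x : G.F) : G.circ (G.pathForm f₀ f) x =
    (if f = x then 1 else 0) - (if f₀ = x then 1 else 0) :=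
  (G.exists_circ_eq f f₀).choose_spec x

/-- An integer `1`-form seen as a `1`-form. -/
def castForm (m : G.E → ℤ) : G.OneForm := fun e => (m e : ℝ)

/-- The exterior derivative on integer `1`-forms. -/
def dInt (m : G.E → ℤ) : G.IntTwoForm f₀ := ⟨fun f => if f = f₀ then 0 else G.circ m f, by simp⟩

theorem dInt_add (m m' : G.E → ℤ) (f : G.F) :
    (G.dInt f₀ (m + m')).1 f = (G.dInt f₀ m).1 f + (G.dInt f₀ m').1 f := by
  by_cases h : f = f₀ <;> simp [dInt, h, circ_add]

theorem toReal_dInt (m : G.E → ℤ) : (G.dInt f₀ m).toReal = G.d f₀ (G.castForm m) := by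
  ext f
  by_cases h : f = f₀ <;> simp [dInt, IntTwoForm.toReal, d, h, circ, castForm]

/-- A linear section of the exterior derivative. -/
def sec : G.TwoForm f₀ →ₗ[ℝ] G.OneForm where
  toFun g e := ∑ f, g.1 f * (G.pathForm f₀ f e : ℝ)
  map_add' g g' := by
    funext e
    simp [add_mul, Finset.sum_add_distrib]
  map_smul' c g := by
    funext e
    simp [Finset.mul_sum, mul_assoc]

/-- The section on integer-valued `2`-forms. -/
def secInt (q : G.IntTwoForm f₀) : G.E → ℤ := fun e => ∑ f, q.1 f * G.pathForm f₀ f e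

theorem castForm_secInt (q : G.IntTwoForm f₀) :
    G.castForm (G.secInt f₀ q) = G.sec f₀ q.toReal := by
  funext e
  simp [castForm, secInt, sec, IntTwoForm.toReal]

theorem d_sec (g : G.TwoForm f₀) : G.d f₀ (G.sec f₀ g) = g := by
  have h0 : g.1 f₀ = 0 := g.2
  ext x
  by_cases hx : x = f₀
  · simp [d, hx, h0]
  have h1 : ∀ f, g.1 f * ∑ e, (G.pathForm f₀ f e : ℝ) *
      ((if G.left e = x then 1 else 0) - (if G.right e = x then 1 else 0)) =
      if f = x then g.1 f else 0 := by
    intro f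
    have h := congrArg (fun z : ℤ => (z : ℝ)) (G.circ_pathForm f₀ f x)
    simp only [circ] at h
    push_cast at h
    rw [h, if_neg (Ne.symm hx)]
    split_ifs <;> simp
  simp only [d, sec, LinearMap.coe_mk, AddHom.coe_mk, if_neg hx, Finset.sum_mul]
  rw [Finset.sum_comm]
  calc _ = ∑ f, g.1 f * ∑ e, (G.pathForm f₀ f e : ℝ) *
      ((if G.left e = x then 1 else 0) - (if G.right e = x then 1 else 0)) := by
        refine Finset.sum_congr rfl fun f _ => ?_
        rw [Finset.mul_sum]
        exact Finset.sum_congr rfl fun e _ => by ring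
    _ = g.1 x := by simp [h1]

theorem toReal_injective : Function.Injective (IntTwoForm.toReal : G.IntTwoForm f₀ → _) := by
  intro q q' h
  ext f
  have := congrFun (congrArg Subtype.val h) f
  simpa [IntTwoForm.toReal] using this

theorem dInt_secInt (q : G.IntTwoForm f₀) : G.dInt f₀ (G.secInt f₀ q) = q := by
  apply G.toReal_injective f₀
  rw [toReal_dInt, castForm_secInt, d_sec]

/-- The projection onto closed `1`-forms along the range of the section. -/
def proj : G.OneForm →ₗ[ℝ] G.OneForm := LinearMap.id - G.sec f₀ ∘ₗ G.d f₀

theorem d_proj (y : G.OneForm) : G.d f₀ (G.proj f₀ y) = 0 := by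
  simp [proj, d_sec]

theorem proj_of_closed {y : G.OneForm} (hy : G.d f₀ y = 0) : G.proj f₀ y = y := by
  simp [proj, hy]

/-- The closed integer `1`-forms. -/
def closedInt : AddSubgroup (G.E → ℤ) where
  carrier := {m | ∀ f, (G.dInt f₀ m).1 f = 0}
  add_mem' := by
    intro a b ha hb f
    rw [dInt_add, ha, hb, add_zero]
  zero_mem' := by
    intro f
    simp [dInt, circ]
  neg_mem' := by
    intro a ha f
    have := ha f
    by_cases h : f = f₀ <;> simp_all [dInt, circ_neg]

theorem d_castForm_closedInt (z : G.closedInt f₀) : G.d f₀ (G.castForm z.1) = 0 := by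
  rw [← toReal_dInt]
  ext f
  simp [IntTwoForm.toReal, z.2 f]

/-- The projection of an integer `1`-form is a closed integer `1`-form. -/
theorem exists_proj_castForm (m : G.E → ℤ) :
    ∃ z : G.closedInt f₀, G.proj f₀ (G.castForm m) = G.castForm z.1 := by
  refine ⟨⟨m - G.secInt f₀ (G.dInt f₀ m), fun f => ?_⟩, ?_⟩
  · have := dInt_add G f₀ (m - G.secInt f₀ (G.dInt f₀ m)) (G.secInt f₀ (G.dInt f₀ m)) f
    rw [sub_add_cancel, dInt_secInt] at this
    omega
  · funext e
    have := congrFun (G.castForm_secInt f₀ (G.dInt f₀ m)) e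
    rw [toReal_dInt] at this
    simp only [castForm] at this
    simp [proj, castForm, this]

/-- An integer `1`-form is determined by its derivative and a closed part. -/
def splitForm : G.IntTwoForm f₀ × G.closedInt f₀ ≃ (G.E → ℤ) where
  toFun p := G.secInt f₀ p.1 + p.2.1
  invFun m := (G.dInt f₀ m, ⟨m - G.secInt f₀ (G.dInt f₀ m), fun f => by
    have := dInt_add G f₀ (m - G.secInt f₀ (G.dInt f₀ m)) (G.secInt f₀ (G.dInt f₀ m)) f
    rw [sub_add_cancel, dInt_secInt] at this
    omega⟩)
  left_inv := by
    rintro ⟨q, z⟩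
    have h : G.dInt f₀ (G.secInt f₀ q + z.1) = q := by
      ext f
      rw [dInt_add, dInt_secInt, z.2 f, add_zero]
    refine Prod.ext h ?_
    ext1
    simp [h]
  right_inv m := by simp

/-! ### Orthogonality -/

theorem sum_mul_dStar_of_closed {y : G.OneForm} (hy : G.d f₀ y = 0) (u : G.TwoForm f₀) :
    ∑ e, y e * G.dStar f₀ u e = 0 := by
  have := G.inner₂_d f₀ y u
  rw [hy] at this
  simp only [inner₂, ZeroMemClass.coe_zero, Pi.zero_apply, zero_mul, Finset.sum_const_zero] at this
  linarith

theorem greenForm_eq_sum (g : G.TwoForm f₀) :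
    G.greenForm f₀ g = ∑ e, (G.dStar f₀ (G.invLaplacian f₀ g) e) ^ 2 := by
  have h := G.inner₂_neg_laplacian f₀ (-G.invLaplacian f₀ g)
  rw [map_neg, neg_neg, laplacian_invLaplacian] at h
  rw [greenForm, h]
  simp [map_neg]

theorem d_dStar_invLaplacian (g : G.TwoForm f₀) :
    G.d f₀ (G.dStar f₀ (G.invLaplacian f₀ g)) = g :=
  G.laplacian_invLaplacian f₀ g

theorem inner₂_ind_sub (u : G.TwoForm f₀) (f f' : G.F) :
    G.inner₂ f₀ (G.ind f₀ f - G.ind f₀ f') u = u.1 f - u.1 f' := by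
  have h0 : u.1 f₀ = 0 := u.2
  have key : ∀ a, ∑ x, (G.ind f₀ a).1 x * u.1 x = u.1 a := by
    intro a
    rw [Finset.sum_eq_single a]
    · by_cases ha : a = f₀
      · simp [ind, ha, h0]
      · simp [ind, ha]
    · intro x _ hx
      simp [ind, hx]
    · simp
  simp [inner₂, sub_mul, Finset.sum_sub_distrib, key]

/-- The observable as a pairing of `1`-forms. -/
theorem invLaplacian_sub_eq (m : G.E → ℤ) (f f' : G.F) :
    (G.invLaplacian f₀ (G.dInt f₀ m).toReal).1 f - (G.invLaplacian f₀ (G.dInt f₀ m).toReal).1 f' =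
      -∑ e, (m e : ℝ) *
        G.dStar f₀ (G.invLaplacian f₀ (G.ind f₀ f - G.ind f₀ f')) e := by
  set u := G.invLaplacian f₀ (G.dInt f₀ m).toReal with hu
  set g := G.invLaplacian f₀ (G.ind f₀ f - G.ind f₀ f') with hg
  have h1 := G.inner₂_ind_sub f₀ u f f'
  rw [← d_dStar_invLaplacian G f₀ (G.ind f₀ f - G.ind f₀ f'), ← hg, inner₂_d] at h1
  -- `m` and `d^*Δ⁻¹(dm)` have the same derivative, so they pair equally with every form in the
  -- range of `d^*`.
  have h2 : G.d f₀ (G.castForm m - G.dStar f₀ u) = 0 := by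
    rw [map_sub, hu, d_dStar_invLaplacian, toReal_dInt, sub_self]
  have h3 := G.sum_mul_dStar_of_closed f₀ h2 g
  simp only [Pi.sub_apply, sub_mul, Finset.sum_sub_distrib, castForm] at h3
  rw [← h1, neg_inj, sub_eq_zero.1 h3]
  exact Finset.sum_congr rfl fun e _ => mul_comm _ _

/-- The closed `1`-form at which the closed part of `q` is centred. -/
def shift (q : G.IntTwoForm f₀) : G.OneForm :=
  G.castForm (G.secInt f₀ q) - G.dStar f₀ (G.invLaplacian f₀ q.toReal)

theorem d_shift (q : G.IntTwoForm f₀) : G.d f₀ (G.shift f₀ q) = 0 := by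
  rw [shift, map_sub, d_dStar_invLaplacian, castForm_secInt, d_sec, sub_self]

/-- The orthogonal decomposition of the Villain energy. -/
theorem sum_sq_sub_proj (q : G.IntTwoForm f₀) (z : G.closedInt f₀) (y : G.OneForm) :
    ∑ e, ((G.splitForm f₀ (q, z) e : ℝ) - G.proj f₀ y e) ^ 2 =
      G.greenForm f₀ q.toReal +
        ∑ e, ((z.1 e : ℝ) - G.proj f₀ (y - G.shift f₀ q) e) ^ 2 := by
  set h := G.dStar f₀ (G.invLaplacian f₀ q.toReal) with hh
  set c : G.OneForm := G.castForm z.1 - G.proj f₀ (y - G.shift f₀ q) with hc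
  have hcl : G.d f₀ c = 0 := by
    rw [hc, map_sub, d_castForm_closedInt, d_proj, sub_self]
  have horth := G.sum_mul_dStar_of_closed f₀ hcl (G.invLaplacian f₀ q.toReal)
  -- The displacement is the sum of the closed form `c` and the form `h` in the range of `d^*`,
  -- which are orthogonal; `h` carries the Green form of `q`.
  have e1 : ∀ e, (G.splitForm f₀ (q, z) e : ℝ) - G.proj f₀ y e = c e + h e := by
    intro e
    rw [hc, map_sub, proj_of_closed G f₀ (d_shift G f₀ q)]
    simp only [splitForm, Equiv.coe_fn_mk, Pi.add_apply, Pi.sub_apply, shift, castForm, ← hh]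
    push_cast
    ring
  have e2 : ∀ e, (z.1 e : ℝ) - G.proj f₀ (y - G.shift f₀ q) e = c e := fun e => rfl
  simp only [e1, e2]
  rw [greenForm_eq_sum, ← hh]
  have : ∑ e, (c e + h e) ^ 2 = ∑ e, h e ^ 2 + ∑ e, c e ^ 2 + 2 * ∑ e, c e * h e := by
    rw [Finset.mul_sum, ← Finset.sum_add_distrib, ← Finset.sum_add_distrib]
    exact Finset.sum_congr rfl fun e _ => by ring
  rw [this, horth]
  ring

end SphereGraph

/-! ### Edge flows are bounded away from one -/

/-- Clipping to an interval is monotone and `1`-Lipschitz. -/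
theorem sq_clip_sub_le (lo hi x y : ℝ) :
    (max lo (min hi x) - max lo (min hi y)) ^ 2 ≤
      (x - y) * (max lo (min hi x) - max lo (min hi y)) := by
  have key : ∀ x y : ℝ, x ≤ y → 0 ≤ max lo (min hi y) - max lo (min hi x) ∧
      max lo (min hi y) - max lo (min hi x) ≤ y - x := by
    intro x y hxy
    constructor
    · have : max lo (min hi x) ≤ max lo (min hi y) := by gcongr
      linarith
    · rcases le_total hi x with h1 | h1 <;> rcases le_total hi y with h2 | h2 <;>
        simp only [min_eq_left, min_eq_right, h1, h2] <;>
        rcases le_total lo hi with h3 | h3 <;> rcases le_total lo x with h4 | h4 <;>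
        rcases le_total lo y with h5 | h5 <;>
        simp only [max_eq_left, max_eq_right, h3, h4, h5] <;> linarith
  rcases le_total x y with h | h
  · obtain ⟨h1, h2⟩ := key x y h
    nlinarith
  · obtain ⟨h1, h2⟩ := key y x h
    nlinarith

namespace SphereGraph

/-- The effective resistance of every dual edge is at most `3/4`. -/
def ResistanceBound (G : SphereGraph) : Prop :=
  ∀ (ψ : G.F → ℝ) (e : G.E), 4 / 3 * (ψ (G.right e) - ψ (G.left e)) ^ 2 ≤
    ∑ e', (ψ (G.right e') - ψ (G.left e')) ^ 2

/-- Truncate the potential `g` to the interval between its values at the two sides of `e`. The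
truncation keeps the drop `D` across `e`, while its energy is at most its pairing with `g`, hence at
most `D` since the current has unit strength. The resistance bound then reads `4/3 * D² ≤ D`. -/
theorem abs_dStar_le {G : SphereGraph} (hG : G.ResistanceBound) (f₀ f f' : G.F) (e : G.E) :
    |G.dStar f₀ (G.invLaplacian f₀ (G.ind f₀ f - G.ind f₀ f')) e| ≤ 3 / 4 := by
  set g := G.invLaplacian f₀ (G.ind f₀ f - G.ind f₀ f') with hg
  have hd : ∀ (u : G.TwoForm f₀) e, G.dStar f₀ u e = u.1 (G.right e) - u.1 (G.left e) := by
    intro u e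
    simp [dStar]
  set lo := min (g.1 (G.left e)) (g.1 (G.right e)) with hlo
  set hi := max (g.1 (G.left e)) (g.1 (G.right e)) with hhi
  have hlh : lo ≤ hi := min_le_max
  set ψ : G.F → ℝ := fun x => max lo (min hi (g.1 x)) with hψ
  have hψe : ∀ x, lo ≤ g.1 x → g.1 x ≤ hi → ψ x = g.1 x := by
    intro x h1 h2
    simp only [hψ]
    rw [min_eq_right h2, max_eq_right h1]
  -- Subtracting a constant makes the truncation vanish at the marked face without changing its
  -- gradient.
  set ψ' : G.TwoForm f₀ := ⟨fun x => ψ x - ψ f₀, sub_self _⟩ with hψ'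
  have h1 := G.inner₂_ind_sub f₀ ψ' f f'
  rw [← d_dStar_invLaplacian G f₀ (G.ind f₀ f - G.ind f₀ f'), ← hg, inner₂_d] at h1
  have hD : hi - lo = |g.1 (G.right e) - g.1 (G.left e)| := by
    rw [hhi, hlo, max_sub_min_eq_abs]
  have h2 : ∑ e', (ψ (G.right e') - ψ (G.left e')) ^ 2 ≤ hi - lo := by
    have h3 : ∑ e', (ψ (G.right e') - ψ (G.left e')) ^ 2 ≤
        ∑ e', G.dStar f₀ g e' * G.dStar f₀ ψ' e' := by
      refine Finset.sum_le_sum fun e' _ => ?_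
      rw [hd, hd]
      simp only [hψ', sub_sub_sub_cancel_right]
      exact sq_clip_sub_le _ _ _ _
    have h4 : ∀ x, ψ x ≤ hi := fun x => max_le hlh (min_le_left _ _)
    have h5 : ∀ x, lo ≤ ψ x := fun x => le_max_left _ _
    have h6 : ψ'.1 f - ψ'.1 f' = ψ f - ψ f' := by simp [hψ']
    linarith [h4 f', h5 f]
  have h7 := hG ψ e
  rw [hψe _ (min_le_right _ _) (le_max_right _ _),
    hψe _ (min_le_left _ _) (le_max_left _ _)] at h7
  rw [hd, ← hD]
  rw [← sq_abs, ← hD] at h7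
  nlinarith

end SphereGraph

/-! ### Effective resistances in the two box graphs -/

/-- The edges around a vertex of the square lattice. -/
def star (v : ℤ × ℤ) : Finset LatticeEdge :=
  {(v, false), (v, true), ((v.1 - 1, v.2), false), ((v.1, v.2 - 1), true)}

/-- The four squares around a vertex form a dual `4`-cycle. The edge `e` is in parallel with a path
of three edges, whose combined conductance is `1 + 1/3 = 4/3`. -/
theorem star_sum_ge (φ : ℤ × ℤ → ℝ) (v : ℤ × ℤ) {e : LatticeEdge} (he : e ∈ star v) :
    4 / 3 * (φ e.rightSquare - φ e.leftSquare) ^ 2 ≤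
      ∑ e' ∈ star v, (φ e'.rightSquare - φ e'.leftSquare) ^ 2 := by
  obtain ⟨x, y⟩ := v
  rw [star, Finset.sum_insert (by simp; omega), Finset.sum_insert (by simp; omega),
    Finset.sum_insert (by simp), Finset.sum_singleton]
  -- The three other differences add up to `p - s`, so by Cauchy-Schwarz their squares sum to at
  -- least `(s - p)²/3`.
  have key : ∀ p q r s : ℝ, 4 / 3 * (s - p) ^ 2 ≤
      (s - p) ^ 2 + ((p - q) ^ 2 + ((r - q) ^ 2 + (s - r) ^ 2)) := by
    intro p q r s
    nlinarith [sq_nonneg ((p - q) - (q - r)), sq_nonneg ((q - r) - (r - s)),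
      sq_nonneg ((p - q) - (r - s))]
  simp only [star, Finset.mem_insert, Finset.mem_singleton] at he
  simp only [LatticeEdge.rightSquare, LatticeEdge.leftSquare]
  have h1 := key (φ (x, y)) (φ (x - 1, y)) (φ (x - 1, y - 1)) (φ (x, y - 1))
  have h2 := key (φ (x, y)) (φ (x, y - 1)) (φ (x - 1, y - 1)) (φ (x - 1, y))
  have h3 := key (φ (x - 1, y)) (φ (x, y)) (φ (x, y - 1)) (φ (x - 1, y - 1))
  have h4 := key (φ (x - 1, y - 1)) (φ (x - 1, y)) (φ (x, y)) (φ (x, y - 1))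
  rcases he with rfl | rfl | rfl | rfl <;> dsimp only <;> linarith

theorem star_sum_le (S : Finset LatticeEdge) (φ : ℤ × ℤ → ℝ) (v : ℤ × ℤ)
    (h : ∀ e ∈ star v, e ∉ S → φ e.rightSquare = φ e.leftSquare) :
    ∑ e ∈ star v, (φ e.rightSquare - φ e.leftSquare) ^ 2 ≤
      ∑ e : S, (φ e.1.rightSquare - φ e.1.leftSquare) ^ 2 := by
  rw [Finset.sum_coe_sort S fun e => (φ e.rightSquare - φ e.leftSquare) ^ 2]
  rw [← Finset.sum_filter_add_sum_filter_not (star v) (· ∈ S)]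
  have h0 : ∑ e ∈ star v with e ∉ S, (φ e.rightSquare - φ e.leftSquare) ^ 2 = 0 := by
    refine Finset.sum_eq_zero fun e he => ?_
    rw [Finset.mem_filter] at he
    rw [h e he.1 he.2, sub_self, zero_pow two_ne_zero]
  rw [h0, add_zero]
  refine Finset.sum_le_sum_of_subset_of_nonneg (fun e he => ?_) fun _ _ _ => sq_nonneg _
  exact (Finset.mem_filter.1 he).2

theorem mem_star_src (e : LatticeEdge) : e ∈ star e.src := by
  obtain ⟨p, b⟩ := e
  cases b <;> simp [star, LatticeEdge.src]

theorem mem_star_tgt (e : LatticeEdge) : e ∈ star e.tgt := by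
  obtain ⟨p, b⟩ := e
  cases b <;> simp [star, LatticeEdge.tgt]

theorem resistanceBound_freeBox (n : ℕ) : (freeBox n).ResistanceBound := by
  intro ψ e
  obtain ⟨e, he⟩ := e
  have hv : e.src ∈ box n := (Finset.mem_filter.1 he).2.1
  refine (star_sum_ge (fun p => ψ (freeFace n p)) e.src (mem_star_src e)).trans ?_
  refine star_sum_le (freeEdges n) (fun p => ψ (freeFace n p)) e.src fun e' he' hn => ?_
  have h1 : ∀ p, p ∉ freeSquares n → freeFace n p = none := fun p hp => dif_neg hp
  generalize e.src = v at hv he'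
  obtain ⟨x, y⟩ := v
  simp only [star, Finset.mem_insert, Finset.mem_singleton] at he'
  -- An edge at a boundary vertex that leaves the box has the outer face on both sides, so leaving
  -- it out of the graph costs no energy.
  have h2 : e'.rightSquare ∉ freeSquares n ∧ e'.leftSquare ∉ freeSquares n := by
    rcases he' with rfl | rfl | rfl | rfl <;>
    simp only [freeSquares, freeEdges, box, LatticeEdge.src, LatticeEdge.tgt,
      LatticeEdge.leftSquare, LatticeEdge.rightSquare, Finset.mem_filter, Finset.mem_product,
      Finset.mem_Icc, Finset.mem_univ, and_true] at hv hn ⊢ <;> omega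
  simp only [h1 _ h2.1, h1 _ h2.2]

theorem resistanceBound_zeroBox (n : ℕ) : (zeroBox n).ResistanceBound := by
  intro ψ e
  obtain ⟨e, he⟩ := e
  have hv : ∃ v ∈ box n, e ∈ star v := by
    rcases (Finset.mem_filter.1 he).2 with h | h
    · exact ⟨_, h, mem_star_src e⟩
    · exact ⟨_, h, mem_star_tgt e⟩
  obtain ⟨⟨x, y⟩, hv, hev⟩ := hv
  set φ : ℤ × ℤ → ℝ := fun p => if h : p ∈ zeroSquares n then ψ ⟨p, h⟩ else 0 with hφ
  have hl : ∀ e : zeroEdges n, ψ ((zeroBox n).left e) = φ e.1.leftSquare := fun e => by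
    simp only [hφ]
    rw [dif_pos (leftSquare_mem_zeroSquares e)]
    rfl
  have hr : ∀ e : zeroEdges n, ψ ((zeroBox n).right e) = φ e.1.rightSquare := fun e => by
    simp only [hφ]
    rw [dif_pos (rightSquare_mem_zeroSquares e)]
    rfl
  have h := (star_sum_ge φ (x, y) hev).trans (star_sum_le (zeroEdges n) φ (x, y) fun e' he' hn => by
    -- All four edges at a vertex of the box belong to the graph, so no edge of the star is missing.
    exfalso
    apply hn
    simp only [star, Finset.mem_insert, Finset.mem_singleton] at he'
    simp only [box, Finset.mem_product, Finset.mem_Icc] at hv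
    rcases he' with rfl | rfl | rfl | rfl <;>
    simp only [mem_zeroEdges_horizontal, mem_zeroEdges_vertical] <;> omega)
  have e1 : 4 / 3 * (ψ ((zeroBox n).right ⟨e, he⟩) - ψ ((zeroBox n).left ⟨e, he⟩)) ^ 2 =
      4 / 3 * (φ e.rightSquare - φ e.leftSquare) ^ 2 := by
    rw [hl ⟨e, he⟩, hr ⟨e, he⟩]
  rw [e1]
  refine h.trans (le_of_eq ?_)
  exact Finset.sum_congr rfl fun e' _ => by rw [hl e', hr e']

theorem resistanceBound_boxGraph (bc : BoundaryCondition) (n : ℕ) :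
    (boxGraph bc n).ResistanceBound := by
  cases bc
  · exact resistanceBound_freeBox n
  · exact resistanceBound_zeroBox n

/-! ### Sums of products over a finite product of copies of `ℤ` -/

theorem pi_count_int (ι : Type) [Fintype ι] :
    Measure.pi (fun _ : ι => (Measure.count : Measure ℤ)) = Measure.count := by
  refine Measure.ext_of_singleton fun m => ?_
  rw [Measure.pi_singleton]
  simp

theorem summable_norm_prod {ι : Type} [Fintype ι] {w : ι → ℤ → ℂ}
    (hw : ∀ i, Summable fun k => ‖w i k‖) : Summable fun m : ι → ℤ => ‖∏ i, w i (m i)‖ := by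
  rw [← integrable_count_iff, ← pi_count_int]
  exact Integrable.fintype_prod fun i => integrable_count_iff.2 (hw i)

/-- Fubini for the counting measure on a finite power of `ℤ`. -/
theorem tsum_prod_eq_prod_tsum {ι : Type} [Fintype ι] {w : ι → ℤ → ℂ}
    (hw : ∀ i, Summable fun k => ‖w i k‖) :
    ∑' m : ι → ℤ, ∏ i, w i (m i) = ∏ i, ∑' k, w i k := by
  have h := integral_fintype_prod_eq_prod w (μ := fun _ : ι => (Measure.count : Measure ℤ))
  rw [pi_count_int, integral_countable (integrable_count_iff.2 (summable_norm_prod hw))] at h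
  simp only [measureReal_def, Measure.count_singleton, ENNReal.toReal_one, one_smul] at h
  rw [h]
  refine Finset.prod_congr rfl fun i _ => ?_
  rw [integral_countable (integrable_count_iff.2 (hw i))]
  simp [measureReal_def]

/-- Uniformity in the centre makes the Villain sums bounded, hence integrable over the cube. After
translation the centre `c` satisfies `c² ≤ 1/4`, and `(k - c)² ≥ k²/2 - c²`. -/
theorem exists_tsum_igWeight_le {b : ℝ} (hb : 0 < b) : ∃ C, ∀ a, ∑' k, igWeight a b k ≤ C := by
  refine ⟨∑' k, Real.exp (b / 8) * igWeight 0 (b / 2) k, fun a => ?_⟩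
  have hc : |a - round a| ≤ 1 / 2 := abs_sub_round a
  have ha : a = (a - round a) + (round a : ℤ) := by ring
  rw [ha, tsum_igWeight_add_int]
  refine (summable_igWeight _ hb).tsum_le_tsum (fun k => ?_)
    ((summable_igWeight 0 (by positivity)).mul_left _)
  rw [igWeight, igWeight, ← Real.exp_add, Real.exp_le_exp]
  set c := a - round a
  have h1 : c ^ 2 ≤ 1 / 4 := by
    rw [← sq_abs]; nlinarith [abs_nonneg c]
  nlinarith [mul_nonneg hb.le (sq_nonneg ((k : ℝ) - 2 * c)), mul_le_mul_of_nonneg_left h1 hb.le]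

namespace SphereGraph

variable (G : SphereGraph) (f₀ : G.F)

/-! ### The Villain weights and the lattice theta function -/

/-- The Villain weight of an integer `1`-form. -/
def villain (b : ℝ) (y : G.OneForm) (m : G.E → ℤ) : ℝ :=
  Real.exp (-(b / 2 * ∑ e, ((m e : ℝ) - G.proj f₀ y e) ^ 2))

theorem villain_eq_prod (b : ℝ) (y : G.OneForm) (m : G.E → ℤ) :
    G.villain f₀ b y m = ∏ e, igWeight (G.proj f₀ y e) b (m e) := by
  simp only [villain, igWeight]
  rw [← Real.exp_sum, Finset.sum_neg_distrib, Finset.mul_sum]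

theorem villain_pos (b : ℝ) (y : G.OneForm) (m : G.E → ℤ) : 0 < G.villain f₀ b y m :=
  Real.exp_pos _

theorem summable_villain {b : ℝ} (hb : 0 < b) (y : G.OneForm) : Summable (G.villain f₀ b y) := by
  have h := summable_norm_prod (w := fun e k => (igWeight (G.proj f₀ y e) b k : ℂ)) fun e => by
    simpa [Real.norm_of_nonneg (igWeight_pos _ _ _).le] using summable_igWeight (G.proj f₀ y e) hb
  refine h.congr fun m => ?_
  rw [← Complex.ofReal_prod, ← villain_eq_prod, Complex.norm_real,
    Real.norm_of_nonneg (villain_pos _ _ _ _ _).le]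

theorem tsum_villain {b : ℝ} (hb : 0 < b) (y : G.OneForm) :
    ∑' m, G.villain f₀ b y m = ∏ e, ∑' k, igWeight (G.proj f₀ y e) b k := by
  have h := tsum_prod_eq_prod_tsum (w := fun e k => (igWeight (G.proj f₀ y e) b k : ℂ)) fun e => by
    simpa [Real.norm_of_nonneg (igWeight_pos _ _ _).le] using summable_igWeight (G.proj f₀ y e) hb
  apply Complex.ofReal_injective
  push_cast
  rw [← h]
  exact tsum_congr fun m => by rw [villain_eq_prod, Complex.ofReal_prod]

/-- The theta function of the lattice of closed integer `1`-forms. -/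
def theta (b : ℝ) (y : G.OneForm) : ℝ := ∑' z : G.closedInt f₀, G.villain f₀ b y z.1

theorem continuous_proj : Continuous (G.proj f₀) :=
  LinearMap.continuous_of_finiteDimensional _

theorem measurable_villain (b : ℝ) (m : G.E → ℤ) : Measurable fun y => G.villain f₀ b y m := by
  have h := G.continuous_proj f₀
  have : Continuous fun y => G.villain f₀ b y m := by
    unfold villain
    fun_prop
  exact this.measurable

theorem measurable_theta (b : ℝ) : Measurable (G.theta f₀ b) :=
  Measurable.tsum fun z => G.measurable_villain f₀ b z.1

theorem theta_pos {b : ℝ} (hb : 0 < b) (y : G.OneForm) : 0 < G.theta f₀ b y :=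
  ((G.summable_villain f₀ hb y).comp_injective Subtype.val_injective).tsum_pos
    (fun z => (G.villain_pos f₀ b y z.1).le) 0 (G.villain_pos f₀ b y _)

theorem exists_tsum_villain_le {b : ℝ} (hb : 0 < b) :
    ∃ C, ∀ y, ∑' m, G.villain f₀ b y m ≤ C := by
  obtain ⟨C, hC⟩ := exists_tsum_igWeight_le hb
  refine ⟨∏ _e : G.E, C, fun y => ?_⟩
  rw [tsum_villain G f₀ hb]
  exact Finset.prod_le_prod (fun e _ => (tsum_igWeight_pos _ hb).le) fun e _ => hC _

theorem theta_le_tsum_villain {b : ℝ} (hb : 0 < b) (y : G.OneForm) :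
    G.theta f₀ b y ≤ ∑' m, G.villain f₀ b y m :=
  tsum_comp_le_tsum_of_inj (G.summable_villain f₀ hb y)
    (fun m => (G.villain_pos f₀ b y m).le) Subtype.val_injective

/-- The section of `d` preserves integrality, so `proj` maps an integer form to a closed integer
form, which the sum over the lattice absorbs. Periodicity under all of `ℤ^E` allows averaging over
the ordinary unit cube, with no fundamental domain of the closed lattice. -/
theorem theta_add_castForm (b : ℝ) (y : G.OneForm) (m : G.E → ℤ) :
    G.theta f₀ b (G.castForm m + y) = G.theta f₀ b y := by
  obtain ⟨z, hz⟩ := G.exists_proj_castForm f₀ m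
  rw [theta, theta, ← (Equiv.addLeft z).tsum_eq]
  refine tsum_congr fun x => ?_
  simp only [villain, map_add, hz, Equiv.coe_addLeft, AddSubgroup.coe_add, Pi.add_apply, castForm]
  push_cast
  congr 3
  exact Finset.sum_congr rfl fun e _ => by ring

/-- The Villain weight factorises along the splitting of integer `1`-forms. -/
theorem villain_splitForm (b : ℝ) (y : G.OneForm) (q : G.IntTwoForm f₀) (z : G.closedInt f₀) :
    G.villain f₀ b y (G.splitForm f₀ (q, z)) =
      Real.exp (-(b / 2 * G.greenForm f₀ q.toReal)) * G.villain f₀ b (y - G.shift f₀ q) z.1 := by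
  rw [villain, villain, sum_sq_sub_proj, ← Real.exp_add]
  ring_nf

theorem dInt_splitForm (q : G.IntTwoForm f₀) (z : G.closedInt f₀) :
    G.dInt f₀ (G.splitForm f₀ (q, z)) = q :=
  congrArg Prod.fst ((G.splitForm f₀).symm_apply_apply (q, z))

/-- Sum over the fibres of `d`: the observable depends on `q` only, and each fibre contributes its
Coulomb weight times a theta function. -/
theorem tsum_villain_mul {b : ℝ} (hb : 0 < b) (y : G.OneForm) {X : G.IntTwoForm f₀ → ℂ}
    (hX : ∀ q, ‖X q‖ = 1) :
    ∑' m, (G.villain f₀ b y m : ℂ) * X (G.dInt f₀ m) =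
      ∑' q, ((Real.exp (-(b / 2 * G.greenForm f₀ q.toReal)) : ℝ) : ℂ) * X q *
        (G.theta f₀ b (y - G.shift f₀ q) : ℂ) := by
  have hs : Summable fun m => (G.villain f₀ b y m : ℂ) * X (G.dInt f₀ m) := by
    refine Summable.of_norm ((G.summable_villain f₀ hb y).congr fun m => ?_)
    rw [norm_mul, hX, mul_one, Complex.norm_real, Real.norm_of_nonneg (villain_pos _ _ _ _ _).le]
  have hs' : Summable fun p => (G.villain f₀ b y (G.splitForm f₀ p) : ℂ) *
      X (G.dInt f₀ (G.splitForm f₀ p)) := (G.splitForm f₀).summable_iff.2 hs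
  rw [← (G.splitForm f₀).tsum_eq, hs'.tsum_prod]
  refine tsum_congr fun q => ?_
  rw [theta, Complex.ofReal_tsum, ← tsum_mul_left]
  refine tsum_congr fun z => ?_
  rw [dInt_splitForm, villain_splitForm]
  push_cast
  ring

/-! ### Averaging over the unit cube -/

/-- The unit cube in the space of `1`-forms. -/
def cube : Set G.OneForm := ZSpan.fundamentalDomain (Pi.basisFun ℝ G.E)

theorem isAddFundamentalDomain_cube :
    IsAddFundamentalDomain (Submodule.span ℤ (Set.range (Pi.basisFun ℝ G.E))).toAddSubgroup
      G.cube volume :=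
  ZSpan.isAddFundamentalDomain' _ _

theorem volume_cube_lt_top : volume G.cube < ∞ :=
  (ZSpan.fundamentalDomain_isBounded _).measure_lt_top

theorem volume_cube_ne_zero : volume G.cube ≠ 0 :=
  ZSpan.measure_fundamentalDomain_ne_zero _

theorem integrableOn_theta_sub {b : ℝ} (hb : 0 < b) (v : G.OneForm) :
    IntegrableOn (fun y => G.theta f₀ b (y - v)) G.cube := by
  obtain ⟨C, hC⟩ := G.exists_tsum_villain_le f₀ hb
  refine Measure.integrableOn_of_bounded (M := C) G.volume_cube_lt_top.ne
    ((G.measurable_theta f₀ b).comp (measurable_id.sub_const v)).aestronglyMeasurable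
    (Filter.Eventually.of_forall fun y => ?_)
  rw [Real.norm_of_nonneg (theta_pos G f₀ hb _).le]
  exact (theta_le_tsum_villain G f₀ hb _).trans (hC _)

-- A translate of the cube is again a fundamental domain of `ℤ^E`, and a periodic function has the
-- same integral over both.
open scoped Pointwise in
theorem setIntegral_theta_sub (b : ℝ) (v : G.OneForm) :
    ∫ y in G.cube, G.theta f₀ b (y - v) = ∫ y in G.cube, G.theta f₀ b y := by
  have h1 := G.isAddFundamentalDomain_cube
  have h2 := h1.vadd_of_comm (-v)
  have h3 : ∫ y in G.cube, G.theta f₀ b (y - v) = ∫ y in -v +ᵥ G.cube, G.theta f₀ b y := by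
    have hm := measurePreserving_add_left (volume : Measure G.OneForm) (-v)
    have he := measurableEmbedding_addLeft (-v)
    have := hm.setIntegral_image_emb he (G.theta f₀ b) G.cube
    rw [← Set.image_vadd]
    simp only [vadd_eq_add]
    rw [this]
    refine integral_congr_ae (Filter.Eventually.of_forall fun y => ?_)
    simp only [neg_add_eq_sub]
  rw [h3]
  have : Countable (Submodule.span ℤ (Set.range (Pi.basisFun ℝ G.E))).toAddSubgroup :=
    inferInstanceAs (Countable (Submodule.span ℤ (Set.range (Pi.basisFun ℝ G.E))))
  refine h2.setIntegral_eq h1 fun g x => ?_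
  obtain ⟨g, hg⟩ := g
  have hg' : ∀ e, ∃ k : ℤ, (k : ℝ) = g e := by
    intro e
    obtain ⟨k, hk⟩ := ((Pi.basisFun ℝ G.E).mem_span_iff_repr_mem ℤ g).1 hg e
    exact ⟨k, by simpa using hk⟩
  choose m hm using hg'
  have : g = G.castForm m := funext fun e => (hm e).symm
  subst this
  exact G.theta_add_castForm f₀ b x m

theorem setIntegral_theta_pos {b : ℝ} (hb : 0 < b) : 0 < ∫ y in G.cube, G.theta f₀ b y := by
  have hi : IntegrableOn (G.theta f₀ b) G.cube := by
    simpa using G.integrableOn_theta_sub f₀ hb 0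
  rw [integral_pos_iff_support_of_nonneg (fun y => (theta_pos G f₀ hb y).le) hi]
  have : Function.support (G.theta f₀ b) = Set.univ :=
    Set.eq_univ_of_forall fun y => (theta_pos G f₀ hb y).ne'
  rw [this, Measure.restrict_apply_univ]
  exact G.volume_cube_ne_zero.bot_lt

theorem setIntegral_tsum_mul_theta {b : ℝ} (hb : 0 < b) {A : G.IntTwoForm f₀ → ℂ}
    (hA : Summable fun q => ‖A q‖) :
    ∫ y in G.cube, ∑' q, A q * (G.theta f₀ b (y - G.shift f₀ q) : ℂ) =
      (∑' q, A q) * ((∫ y in G.cube, G.theta f₀ b y : ℝ) : ℂ) := by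
  have hn : ∀ q, ∫ y in G.cube, ‖A q * (G.theta f₀ b (y - G.shift f₀ q) : ℂ)‖ =
      ‖A q‖ * ∫ y in G.cube, G.theta f₀ b y := by
    intro q
    rw [← setIntegral_theta_sub G f₀ b (G.shift f₀ q), ← integral_const_mul]
    refine integral_congr_ae (Filter.Eventually.of_forall fun y => ?_)
    simp only [norm_mul, Complex.norm_real, Real.norm_of_nonneg (theta_pos G f₀ hb _).le]
  have h := hasSum_integral_of_summable_integral_norm (μ := volume.restrict G.cube)
    (F := fun q y => A q * (G.theta f₀ b (y - G.shift f₀ q) : ℂ))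
    (fun q => ((G.integrableOn_theta_sub f₀ hb _).ofReal).const_mul (A q)) (by
      simp only [hn]
      exact hA.mul_right _)
  rw [← h.tsum_eq, ← tsum_mul_right]
  refine tsum_congr fun q => ?_
  rw [integral_const_mul, integral_complex_ofReal, setIntegral_theta_sub]

/-! ### The bound for the Coulomb gas -/

theorem integrableOn_tsum_villain {b : ℝ} (hb : 0 < b) :
    IntegrableOn (fun y => ∑' m, G.villain f₀ b y m) G.cube := by
  obtain ⟨C, hC⟩ := G.exists_tsum_villain_le f₀ hb
  refine Measure.integrableOn_of_bounded (M := C) G.volume_cube_lt_top.ne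
    (Measurable.tsum fun m => G.measurable_villain f₀ b m).aestronglyMeasurable
    (Filter.Eventually.of_forall fun y => ?_)
  rw [Real.norm_of_nonneg (tsum_nonneg fun m => (villain_pos G f₀ b y m).le)]
  exact hC y

theorem summable_exp_greenForm {b : ℝ} (hb : 0 < b) : Summable fun q : G.IntTwoForm f₀ =>
    Real.exp (-(b / 2 * G.greenForm f₀ q.toReal)) := by
  have h := G.summable_coulombGas f₀ (β := b / (2 * Real.pi) ^ 2) (by positivity)
  refine h.congr fun q => ?_
  congr 3
  field_simp

/-- Comparison of Coulomb sums through the Villain model. -/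
theorem norm_tsum_coulomb_le {b ρ : ℝ} (hb : 0 < b) {X : G.IntTwoForm f₀ → ℂ}
    (hX : ∀ q, ‖X q‖ = 1)
    (h : ∀ y, ‖∑' m, (G.villain f₀ b y m : ℂ) * X (G.dInt f₀ m)‖ ≤
      ρ * ∑' m, G.villain f₀ b y m) :
    ‖∑' q, ((Real.exp (-(b / 2 * G.greenForm f₀ q.toReal)) : ℝ) : ℂ) * X q‖ ≤
      ρ * ∑' q : G.IntTwoForm f₀, Real.exp (-(b / 2 * G.greenForm f₀ q.toReal)) := by
  set w : G.IntTwoForm f₀ → ℝ := fun q => Real.exp (-(b / 2 * G.greenForm f₀ q.toReal)) with hw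
  have hsum : Summable w := G.summable_exp_greenForm f₀ hb
  have hwX : ∀ Y : G.IntTwoForm f₀ → ℂ, (∀ q, ‖Y q‖ = 1) → Summable fun q => ‖(w q : ℂ) * Y q‖ := by
    intro Y hY
    refine hsum.congr fun q => ?_
    rw [norm_mul, hY, mul_one, Complex.norm_real, Real.norm_of_nonneg (Real.exp_pos _).le]
  have hc := G.setIntegral_theta_pos f₀ hb
  set c := ∫ y in G.cube, G.theta f₀ b y with hcdef
  have h1 := G.setIntegral_tsum_mul_theta f₀ hb (hwX X hX)
  have h2 := G.setIntegral_tsum_mul_theta f₀ hb (hwX (fun _ => 1) fun _ => by simp)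
  have h3 : ∀ y, ∑' m, (G.villain f₀ b y m : ℂ) * X (G.dInt f₀ m) =
      ∑' q, (w q : ℂ) * X q * (G.theta f₀ b (y - G.shift f₀ q) : ℂ) := fun y =>
    G.tsum_villain_mul f₀ hb y hX
  have h4 : ∀ y, ((∑' m, G.villain f₀ b y m : ℝ) : ℂ) =
      ∑' q, (w q : ℂ) * 1 * (G.theta f₀ b (y - G.shift f₀ q) : ℂ) := fun y => by
    rw [← G.tsum_villain_mul f₀ hb y (X := fun _ => 1) fun _ => by simp]
    push_cast
    simp
  -- The cube averages of the Villain sums, with and without `X`, are now the corresponding Coulomb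
  -- sums times the same constant `c`.
  simp only [← h3, ← h4] at h1 h2
  rw [integral_complex_ofReal] at h2
  have h5 : ∫ y in G.cube, ∑' m, G.villain f₀ b y m = (∑' q, w q) * c := by
    apply Complex.ofReal_injective
    rw [h2, ← hcdef]
    push_cast
    simp only [mul_one]
  -- Integrate the hypothesis over `y`; the factor `c > 0` then cancels from both sides.
  have h6 := norm_integral_le_of_norm_le (μ := volume.restrict G.cube)
    ((G.integrableOn_tsum_villain f₀ hb).const_mul ρ) (Filter.Eventually.of_forall h)
  rw [h1, integral_const_mul, h5, norm_mul, Complex.norm_real, Real.norm_of_nonneg hc.le,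
    ← mul_assoc] at h6
  exact le_of_mul_le_mul_right h6 hc

/-- The observable of the Coulomb gas. -/
def observable (f f' : G.F) (q : G.IntTwoForm f₀) : ℂ :=
  Complex.exp (2 * Complex.I * Real.pi *
    ((G.invLaplacian f₀ q.toReal).1 f - (G.invLaplacian f₀ q.toReal).1 f'))

theorem norm_observable (f f' : G.F) (q : G.IntTwoForm f₀) : ‖G.observable f₀ f f' q‖ = 1 := by
  rw [observable, ← Complex.norm_exp_ofReal_mul_I (2 * Real.pi *
    ((G.invLaplacian f₀ q.toReal).1 f - (G.invLaplacian f₀ q.toReal).1 f'))]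
  push_cast
  ring_nf

theorem observable_dInt (f f' : G.F) (m : G.E → ℤ) :
    G.observable f₀ f f' (G.dInt f₀ m) =
      ∏ e, Complex.exp ((2 * Real.pi *
        (-G.dStar f₀ (G.invLaplacian f₀ (G.ind f₀ f - G.ind f₀ f')) e) * m e : ℝ) *
          Complex.I) := by
  have h := congrArg (fun x : ℝ => (x : ℂ)) (G.invLaplacian_sub_eq f₀ m f f')
  rw [observable, ← Complex.exp_sum]
  congr 1
  push_cast at h ⊢
  rw [h, ← Finset.sum_neg_distrib, Finset.mul_sum]
  exact Finset.sum_congr rfl fun e _ => by ring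

/-- The observable is a product over edges by linearity in `m`, and so is the weight; the edges are
independent once `y` is fixed. -/
theorem tsum_villain_mul_observable {b : ℝ} (hb : 0 < b) (y : G.OneForm) (f f' : G.F) :
    ∑' m, (G.villain f₀ b y m : ℂ) * G.observable f₀ f f' (G.dInt f₀ m) =
      ∏ e, igFourier (G.proj f₀ y e) b
        (-G.dStar f₀ (G.invLaplacian f₀ (G.ind f₀ f - G.ind f₀ f')) e) := by
  simp only [igFourier]
  rw [← tsum_prod_eq_prod_tsum fun e => summable_igFourier _ _ hb]
  refine tsum_congr fun m => ?_
  rw [observable_dInt, villain_eq_prod, Complex.ofReal_prod, Finset.prod_mul_distrib]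

theorem coulombCharFun_eq {β : ℝ} (hβ : 0 < β) (f f' : G.F) :
    G.coulombCharFun f₀ β f f' =
      ((∑' q : G.IntTwoForm f₀,
        Real.exp (-((2 * Real.pi) ^ 2 * β / 2 * G.greenForm f₀ q.toReal)))⁻¹ : ℝ) *
      ∑' q : G.IntTwoForm f₀,
        ((Real.exp (-((2 * Real.pi) ^ 2 * β / 2 * G.greenForm f₀ q.toReal)) : ℝ) : ℂ) *
          G.observable f₀ f f' q := by
  have e : ∀ q : G.IntTwoForm f₀, β * (2 * Real.pi) ^ 2 / 2 * G.greenForm f₀ q.toReal =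
      (2 * Real.pi) ^ 2 * β / 2 * G.greenForm f₀ q.toReal := fun q => by ring
  have hs := G.summable_coulombGas f₀ hβ
  have h := integral_gibbs hs (f := G.observable f₀ f f') (by
    simpa only [norm_observable, mul_one] using hs)
  have hgas : G.coulombGas f₀ β =
      gibbs fun q => (2 * Real.pi) ^ 2 * β / 2 * G.greenForm f₀ q.toReal := by
    simp only [coulombGas, e]
  simp only [e, Complex.real_smul] at h
  rw [coulombCharFun, hgas]
  exact h

theorem coulombCharFun_im {β : ℝ} (hβ : 0 < β) (f f' : G.F) :
    (G.coulombCharFun f₀ β f f').im = 0 := by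
  rw [← Complex.conj_eq_iff_im, coulombCharFun_eq G f₀ hβ, map_mul, Complex.conj_ofReal,
    Complex.conj_tsum]
  congr 1
  -- The gas is invariant under `q ↦ -q`, which conjugates the observable.
  let ν : G.IntTwoForm f₀ ≃ G.IntTwoForm f₀ :=
    { toFun := fun q => ⟨fun f => -q.1 f, by simp [q.2]⟩
      invFun := fun q => ⟨fun f => -q.1 f, by simp [q.2]⟩
      left_inv := fun q => by simp
      right_inv := fun q => by simp }
  have hν : ∀ q, (ν q).toReal = -q.toReal := by
    intro q
    ext f
    simp [ν, IntTwoForm.toReal]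
  rw [← ν.tsum_eq]
  refine tsum_congr fun q => ?_
  have hg : G.greenForm f₀ (-q.toReal) = G.greenForm f₀ q.toReal := by
    simp [greenForm, inner₂]
  rw [map_mul, Complex.conj_ofReal, observable, observable, hν, hg, ← Complex.exp_conj]
  congr 2
  simp only [map_mul, map_sub, map_neg, map_ofNat, Complex.conj_I, Complex.conj_ofReal,
    Submodule.coe_neg, Pi.neg_apply]
  push_cast
  ring

theorem norm_coulombCharFun_le {G : SphereGraph} (hG : G.ResistanceBound) (f₀ f f' : G.F) {β : ℝ}
    (hβ : 1 / 3 ≤ β) : ‖G.coulombCharFun f₀ β f f'‖ ≤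
      Real.exp (-(minVarIG ((2 * Real.pi) ^ 2 * β) / 4 *
        G.greenForm f₀ (G.ind f₀ f - G.ind f₀ f'))) := by
  -- Here `β ≥ 1/3` enters: `π > 3` gives `(2π)²/3 > 12`.
  have hb : 12 ≤ (2 * Real.pi) ^ 2 * β := by
    nlinarith [Real.pi_gt_three]
  have hb0 : 0 < (2 * Real.pi) ^ 2 * β := by linarith
  have h := G.norm_tsum_coulomb_le f₀ hb0
    (ρ := Real.exp (-(minVarIG ((2 * Real.pi) ^ 2 * β) / 4 *
        G.greenForm f₀ (G.ind f₀ f - G.ind f₀ f'))))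
    (G.norm_observable f₀ f f') (fun y => by
      rw [tsum_villain_mul_observable G f₀ hb0, tsum_villain G f₀ hb0, norm_prod,
        greenForm_eq_sum, Finset.mul_sum, ← Finset.sum_neg_distrib, Real.exp_sum,
        ← Finset.prod_mul_distrib]
      refine Finset.prod_le_prod (fun _ _ => norm_nonneg _) fun e _ => ?_
      refine (norm_igFourier_le _ hb (by rw [abs_neg]; exact abs_dStar_le hG f₀ f f' e)).trans ?_
      rw [neg_sq])
  have hZ : 0 < ∑' q : G.IntTwoForm f₀,
      Real.exp (-((2 * Real.pi) ^ 2 * β / 2 * G.greenForm f₀ q.toReal)) :=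
    (G.summable_exp_greenForm f₀ hb0).tsum_pos (fun _ => (Real.exp_pos _).le) ⟨0, rfl⟩
      (Real.exp_pos _)
  rw [coulombCharFun_eq G f₀ (by linarith), norm_mul, Complex.norm_real,
    Real.norm_of_nonneg (inv_pos.2 hZ).le, inv_mul_le_iff₀ hZ]
  exact h.trans (le_of_eq (mul_comm _ _))

end SphereGraph

end Coulomb

end

theorem mainTheorem3 :
    ∃ K : ℝ, ∀ (β : ℝ), 1 / 3 ≤ β →
      ∀ (bc : Coulomb.BoundaryCondition) (n : ℕ), 1 ≤ n →
      ∀ f₀ f f' : (Coulomb.boxGraph bc n).F,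
        ((Coulomb.boxGraph bc n).coulombCharFun f₀ β f f').im = 0 ∧
        ((Coulomb.boxGraph bc n).coulombCharFun f₀ β f f').re ≤
          K * Real.exp (-(1 / 2) * (Coulomb.errorM β / (2 * (2 * Real.pi) ^ 2 * β)) *
            (Coulomb.boxGraph bc n).greenForm f₀
              ((Coulomb.boxGraph bc n).ind f₀ f - (Coulomb.boxGraph bc n).ind f₀ f')) := by
  -- No multiplicative loss occurs, so `K = 1`. The prefactor `(2π)²β` of `errorM` cancels, leaving
  -- a quarter of the minimal variance.
  refine ⟨1, fun β hβ bc n _ f₀ f f' => ?_⟩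
  have hβ0 : 0 < β := by linarith
  refine ⟨Coulomb.SphereGraph.coulombCharFun_im _ f₀ hβ0 f f', ?_⟩
  refine (Complex.re_le_norm _).trans ((Coulomb.SphereGraph.norm_coulombCharFun_le
    (Coulomb.resistanceBound_boxGraph bc n) f₀ f f' hβ).trans (le_of_eq ?_))
  rw [one_mul, Coulomb.errorM, ← Coulomb.minVarIG]
  congr 1
  have := Real.pi_pos
  field_simp
  ring
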